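/- For $\mu\in\mathbb R$, $\sigma>0$, $1<\alpha\le 2$, $|\beta|\le 1$ let $f(x;\mu,\sigma,\alpha,\beta)$ be the density of the stable distribution with characteristic function $$\Phi(t)=\exp\Big(-|\sigma t|^{\alpha}\big\{1+i\beta\,\mathrm{sgn}(t)\tan(\tfrac{\pi\alpha}{2})(|\sigma t|^{1-\alpha}-1)\big\}+i\mu t\Big),$$ i.e. $f(x;\mu,\sigma,\alpha,\beta)=\frac1{2\pi}\int_{\mathbb R}e^{-itx}\Phi(t)\,dt$. Write $f(x;\alpha,\beta)=f(x;0,1,\alpha,\beta)$ and let $f_\mu(x;\alpha,\beta)=\partial_\mu f(x;\mu,1,\alpha,\beta)|_{\mu=0}$. Put $\Delta=2-\alpha$, $\zeta=-\beta\tan(\pi\alpha/2)$, $\beta^*=\beta\,\mathrm{sgn}(x-\zeta)$, $f(y;2)=\frac{1}{2\sqrt\pi}e^{-y^2/4}$, and define $$g=f(x-\zeta;2)+(1+\beta^*)\Delta|x-\zeta|^{\Delta-3},$$ $$g'=-\tfrac{x-\zeta}{2}f(x-\zeta;2)-3(1+\beta^*)\Delta\,\mathrm{sgn}(x-\zeta)|x-\zeta|^{\Delta-4},\qquad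 g_\mu=-g'$$ (the symbol $g'$ is this expression; it is not exactly the derivative of $g$). Fix $\beta$ with $-1<\beta<1$. Then the following hold. 1. For every $\epsilon>0$ there exist $\Delta_0>0$ and $x_0>0$ such that for all $0<\Delta<\Delta_0$ and $|x|>x_0$, $$\left|\frac{f_\mu(x;\alpha,\beta)}{g_\mu(x;\alpha,\beta)}-1\right|<\epsilon\quad\text{and}\quad\left|\frac{f_\mu(x;\alpha,\beta)/f(x;\alpha,\beta)}{g_\mu(x;\alpha,\beta)/g(x;\alpha,\beta)}-1\right|<\epsilon .$$ 2. For every $0<\delta<2$ and every $x_0>0$, as $\Delta\downarrow0$ and uniformly in $|x|>x_0$, $$\frac{g_\mu(x;\alpha,\beta)}{g(x;\alpha,\beta)}=\begin{cases}\dfrac{x-\zeta}{2}\,\bigl(1+o(\Delta^{\delta/2})\bigr)&\text{if }|x-\zeta|\le(2-\delta)(\log 1/\Delta)^{1/2},\\[2mm]\dfrac{3}{x-\zeta}\,\bigl(1+o(\Delta^{\delta/2})\bigr)&\text{if }|x-\zeta|\ge(2+\delta)(\log 1/\Delta)^{1/2}.\end{cases}$$ 3. There is a constant $c>0$, depending at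 most on $\beta$, such that for every $0<\delta<2$ and every $x_0>0$ there is $\Delta_0>0$ such that, for all $0<\Delta<\Delta_0$ and all $|x|>x_0$ for which $|x-\zeta|$ or $|x|$ lies in the interval $\bigl[(2-\delta)(\log1/\Delta)^{1/2},\,(2+\delta)(\log1/\Delta)^{1/2}\bigr]$, $$\left|\frac{g_\mu(x;\alpha,\beta)}{g(x;\alpha,\beta)}\right|\le c\,|x| .$$ -/

import Mathlib

open MeasureTheory

noncomputable section

/-- The characteristic function of the general stable distribution with location `μ`, scale `σ`,
exponent `α ≠ 1` and skewness `β`, in the (M) parameterization. -/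
def stableCF (μ σ α β t : ℝ) : ℂ :=
  Complex.exp
    (-((|σ * t| ^ α : ℝ) : ℂ) *
        (1 + Complex.I *
          ((β * Real.sign t * Real.tan (Real.pi * α / 2) * (|σ * t| ^ (1 - α) - 1) : ℝ) : ℂ))
      + Complex.I * ((μ * t : ℝ) : ℂ))

/-- The density `f(x; μ, σ, α, β)` of the stable distribution, given by Fourier inversion of its
(integrable) characteristic function. See `eq_stableDensity_of_charFun`. -/
def stableDensity (μ σ α β x : ℝ) : ℝ :=
  (1 / (2 * Real.pi)) *
    (∫ t : ℝ, Complex.exp (-(Complex.I * ((t * x : ℝ) : ℂ))) * stableCF μ σ α β t).re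

/-- The partial derivative of `f(x; μ, σ, α, β)` with respect to `μ` at `(μ, σ) = (0, 1)`. -/
def stableDensityMu (α β x : ℝ) : ℝ :=
  deriv (fun μ : ℝ => stableDensity μ 1 α β x) 0

/-- The shift `ζ = -β tan(πα/2)`. -/
def stableShift (α β : ℝ) : ℝ := -β * Real.tan (Real.pi * α / 2)

/-- The density of the normal distribution `N(0, 2)`. -/
def normalDensityTwo (y : ℝ) : ℝ := 1 / (2 * Real.sqrt Real.pi) * Real.exp (-y ^ 2 / 4)

/-- `F₁ = f(x - ζ; 2)`. -/
def gaussPart (α β x : ℝ) : ℝ := normalDensityTwo (x - stableShift α β)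

/-- `F₂ = (1 + β*) Δ |x - ζ| ^ (Δ - 3)` with `Δ = 2 - α` and `β* = β sgn (x - ζ)`. -/
def tailPart (α β x : ℝ) : ℝ :=
  (1 + β * Real.sign (x - stableShift α β)) * (2 - α) *
    |x - stableShift α β| ^ ((2 - α) - 3)

/-- `F₁' = -((x - ζ) / 2) f(x - ζ; 2)`. -/
def gaussPart' (α β x : ℝ) : ℝ :=
  -((x - stableShift α β) / 2) * normalDensityTwo (x - stableShift α β)

/-- `F₂' = -3 (1 + β*) Δ sgn (x - ζ) |x - ζ| ^ (Δ - 4)`. The factor is `3`, not `3 - Δ`. -/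
def tailPart' (α β x : ℝ) : ℝ :=
  -3 * (1 + β * Real.sign (x - stableShift α β)) * (2 - α) *
    (Real.sign (x - stableShift α β) * |x - stableShift α β| ^ ((2 - α) - 4))

/-- The approximation `g = F₁ + F₂` of the density. -/
def approxDensity (α β x : ℝ) : ℝ := gaussPart α β x + tailPart α β x

/-- The approximation `g' = F₁' + F₂'` of the derivative of the density in `x`. -/
def approxDensity' (α β x : ℝ) : ℝ := gaussPart' α β x + tailPart' α β x

/-- `g_μ = -g'`, the approximation of the derivative of the density in `μ`. -/
def approxMu (α β x : ℝ) : ℝ := -approxDensity' α β x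

lemma norm_stableCF (μ σ α β t : ℝ) : ‖stableCF μ σ α β t‖ = Real.exp (-|σ * t| ^ α) := by
  rw [stableCF, Complex.norm_exp]
  congr 1
  simp only [Complex.add_re, Complex.mul_re, Complex.neg_re, Complex.neg_im, Complex.ofReal_re,
    Complex.ofReal_im, Complex.I_re, Complex.I_im, Complex.one_re]
  ring

lemma integrable_exp_neg_abs_rpow {α : ℝ} (hα : 0 < α) :
    Integrable (fun t : ℝ => Real.exp (-|t| ^ α)) := by
  have h1 : IntegrableOn (fun t : ℝ => Real.exp (-|t| ^ α)) (Set.Ioi 0) := by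
    refine (integrableOn_rpow_mul_exp_neg_rpow (s := 0) (by norm_num) hα).congr_fun
      (fun x hx => ?_) measurableSet_Ioi
    simp [abs_of_pos (Set.mem_Ioi.1 hx)]
  have h2 : IntegrableOn (fun t : ℝ => Real.exp (-|t| ^ α)) (Set.Iic 0) := by
    have := (integrableOn_Ici_iff_integrableOn_Ioi (b := (0 : ℝ))).2 h1
    rw [← neg_zero] at this
    simpa using this.comp_neg_Iic
  rw [← integrableOn_univ, ← Set.Iic_union_Ioi (a := (0 : ℝ))]
  exact h2.union h1

/-- `stableDensity` is the density of the stable law: if a probability measure with characteristic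
function `stableCF` has a continuous density, then that density is `stableDensity`. -/
theorem eq_stableDensity_of_charFun {μ σ α β : ℝ} (hσ : 0 < σ) (hα : 0 < α)
    (P : Measure ℝ) [IsProbabilityMeasure P] (hP : ∀ t, charFun P t = stableCF μ σ α β t)
    (f : ℝ → ℝ) (hf : Continuous f) (hf0 : ∀ x, 0 ≤ f x)
    (hPf : P = volume.withDensity (fun x => ENNReal.ofReal (f x))) :
    f = stableDensity μ σ α β := by
  have hfi : Integrable f := by
    refine ⟨hf.aestronglyMeasurable, ?_⟩
    rw [hasFiniteIntegral_iff_ofReal (Filter.Eventually.of_forall hf0)]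
    have h : P Set.univ = 1 := measure_univ
    rw [hPf, withDensity_apply _ MeasurableSet.univ, Measure.restrict_univ] at h
    simp [h]
  have hFT : ∀ w : ℝ, FourierTransform.fourier (fun x : ℝ => (f x : ℂ)) w
      = stableCF μ σ α β (-(2 * Real.pi) * w) := by
    intro w
    rw [← hP, charFun_apply_real, Real.fourier_real_eq_integral_exp_smul, hPf,
      integral_withDensity_eq_integral_toReal_smul (by fun_prop)
        (Filter.Eventually.of_forall fun x => ENNReal.ofReal_lt_top)]
    refine integral_congr_ae (Filter.Eventually.of_forall fun x => ?_)
    simp only [ENNReal.toReal_ofReal (hf0 x), smul_eq_mul, Complex.real_smul]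
    rw [mul_comm]
    congr 2
    push_cast
    ring
  have hπ : (-(2 * Real.pi)) ≠ 0 := by simp [Real.pi_ne_zero]
  have hΦi : Integrable (stableCF μ σ α β) := by
    have hm : Measurable (stableCF μ σ α β) := by
      rw [← funext hP]
      exact measurable_charFun
    have := (integrable_exp_neg_abs_rpow hα).comp_mul_left' hσ.ne'
    refine this.mono' hm.aestronglyMeasurable (Filter.Eventually.of_forall fun t => ?_)
    exact (norm_stableCF μ σ α β t).le
  have hFi : Integrable (FourierTransform.fourier (fun x : ℝ => (f x : ℂ))) := by
    rw [funext hFT]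
    exact hΦi.comp_mul_left' hπ
  have hinv := (Complex.continuous_ofReal.comp hf).fourierInv_fourier_eq hfi.ofReal hFi
  funext x
  have hx := congrFun hinv x
  rw [Real.fourierInv_eq'] at hx
  have key : ∀ w : ℝ, Complex.exp ((((2 * Real.pi * inner ℝ w x : ℝ) : ℂ)) * Complex.I) •
        FourierTransform.fourier (fun x : ℝ => (f x : ℂ)) w
      = (fun t : ℝ => Complex.exp (-(Complex.I * ((t * x : ℝ) : ℂ))) * stableCF μ σ α β t)
          (-(2 * Real.pi) * w) := by
    intro w
    simp only [hFT, smul_eq_mul]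
    congr 2
    simp
    ring
  have hx2 : (f x : ℂ) = ((1 / (2 * Real.pi) : ℝ) : ℂ) *
      ∫ t : ℝ, Complex.exp (-(Complex.I * ((t * x : ℝ) : ℂ))) * stableCF μ σ α β t := by
    refine Eq.trans hx.symm ?_
    refine (integral_congr_ae (Filter.Eventually.of_forall key)).trans ?_
    refine (Measure.integral_comp_mul_left (fun t : ℝ =>
      Complex.exp (-(Complex.I * ((t * x : ℝ) : ℂ))) * stableCF μ σ α β t) _).trans ?_
    rw [Complex.real_smul]
    congr 2
    rw [abs_inv, abs_neg, abs_of_pos Real.two_pi_pos, one_div]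
  have := congrArg Complex.re hx2
  rwa [Complex.ofReal_re, Complex.re_ofReal_mul] at this

end

/-! With y = x − ζ, the product |t|^α |t|^(1−α) = |t| in the characteristic function is a pure
drift, so f(x; μ, 1, α, β) = h(y − μ), where h(y) is 1/π times the real part of ∫₀^∞ exp(−ity − t^α
(1 + iζ)) dt. Hence f_μ = −h′, and the kth derivatives of h (k = 0, 1) are treated together by
inserting (−it)^k. For α = 2, ζ = 0 this is the density of N(0, 2).

For y > 0 the path is moved from the positive axis to the segment from 0 to −i followed by the
half-line −i + [0, ∞). On the half-line the kernel carries e^(−y), and the stable and Gaussian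
kernels differ there by O(Δ), so it contributes O(Δ e^(−y)) to the difference
(`exists_abs_stableHalfLine_sub_le`). On the segment only the imaginary part of the kernel counts.
It vanishes for the Gaussian; otherwise it is governed by sin(B s^α) with B = (1 + β) sin(πΔ/2), and
a Watson-type estimate (`abs_stableVertical_sub_le`) gives a power tail of order Δ y^(Δ−3−k). Its
coefficient is asymptotic to (1 + β) Δ Γ(k+3)/2: the factors 1 and 3 in g and g′. Negative y follows
by reflection, β ↦ −β.

The total error is thus small relative to the tail term alone, even where the Gaussian term
dominates. The two terms of g, and the two of g_μ, have the same sign and cannot cancel, which gives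
claim 1. For claims 2 and 3, g_μ/g is the mean of y/2 and 3/y weighted by the Gaussian and tail
terms; exp(−y²/4) and Δ balance at |y| = 2(log 1/Δ)^(1/2), where the dominant weight changes. -/

open MeasureTheory

/-! ### Complex-analytic tools: Lipschitz bound, contour shift, powers in a strip -/

/-- On a left half-plane the complex exponential is Lipschitz. -/
lemma norm_exp_sub_exp_le_of_re_le {M : ℝ} {a b : ℂ} (ha : a.re ≤ M) (hb : b.re ≤ M) :
    ‖Complex.exp a - Complex.exp b‖ ≤ Real.exp M * ‖a - b‖ := by
  have hs : Convex ℝ {z : ℂ | z.re ≤ M} := convex_halfSpace_re_le M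
  refine hs.norm_image_sub_le_of_norm_hasDerivWithin_le (f := Complex.exp) (f' := Complex.exp)
    (fun z _ => (Complex.hasDerivAt_exp z).hasDerivWithinAt) (fun z hz => ?_) hb ha
  rw [Complex.norm_exp]
  exact Real.exp_le_exp.2 hz

/-- Shifting the path of integration from the positive real axis into the lower half-plane. -/
lemma integral_Ioi_eq_vertical_add_shifted {F : ℂ → ℂ} {C b : ℝ} (hb : 0 < b)
    (hc : ContinuousOn F {z | 0 ≤ z.re ∧ -1 ≤ z.im ∧ z.im ≤ 0})
    (hd : DifferentiableOn ℂ F {z | 0 < z.re})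
    (hF : ∀ z : ℂ, 0 ≤ z.re → -1 ≤ z.im → z.im ≤ 0 → ‖F z‖ ≤ C * Real.exp (-b * z.re)) :
    ∫ t in Set.Ioi (0 : ℝ), F t =
      -Complex.I * (∫ s in (0 : ℝ)..1, F (-(s * Complex.I))) +
        ∫ t in Set.Ioi (0 : ℝ), F (t - Complex.I) := by
  have hexp : IntegrableOn (fun t : ℝ => C * Real.exp (-b * t)) (Set.Ioi 0) :=
    (integrableOn_exp_mul_Ioi (by linarith) 0).const_mul C
  have hi0 : IntegrableOn (fun t : ℝ => F t) (Set.Ioi 0) := by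
    refine Integrable.mono' hexp ?_ ?_
    · refine ContinuousOn.aestronglyMeasurable ?_ measurableSet_Ioi
      refine hc.comp (by fun_prop) fun t ht => ?_
      simpa using (Set.mem_Ioi.1 ht).le
    · refine (ae_restrict_iff' measurableSet_Ioi).2 (Filter.Eventually.of_forall fun t ht => ?_)
      simpa using hF (t : ℂ) (by simpa using (Set.mem_Ioi.1 ht).le) (by simp) (by simp)
  have hi1 : IntegrableOn (fun t : ℝ => F (t - Complex.I)) (Set.Ioi 0) := by
    refine Integrable.mono' hexp ?_ ?_
    · refine ContinuousOn.aestronglyMeasurable ?_ measurableSet_Ioi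
      refine hc.comp (by fun_prop) fun t ht => ?_
      simpa using (Set.mem_Ioi.1 ht).le
    · refine (ae_restrict_iff' measurableSet_Ioi).2 (Filter.Eventually.of_forall fun t ht => ?_)
      simpa using hF (t - Complex.I) (by simpa using (Set.mem_Ioi.1 ht).le) (by simp) (by simp)
  have l0 := intervalIntegral_tendsto_integral_Ioi 0 hi0 Filter.tendsto_id
  have l1 := intervalIntegral_tendsto_integral_Ioi 0 hi1 Filter.tendsto_id
  have l2 : Filter.Tendsto (fun R : ℝ => ∫ y in (-1 : ℝ)..0, F (R + y * Complex.I))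
      Filter.atTop (nhds 0) := by
    have he : Filter.Tendsto (fun R : ℝ => C * Real.exp (-b * R)) Filter.atTop (nhds 0) := by
      have : Filter.Tendsto (fun R : ℝ => -b * R) Filter.atTop Filter.atBot :=
        Filter.tendsto_id.const_mul_atTop_of_neg (by linarith)
      simpa using (Real.tendsto_exp_atBot.comp this).const_mul C
    refine squeeze_zero_norm' ?_ he
    filter_upwards [Filter.eventually_ge_atTop 0] with R hR
    have := intervalIntegral.norm_integral_le_of_norm_le_const (a := (-1 : ℝ)) (b := 0)
      (f := fun y : ℝ => F (R + y * Complex.I)) (C := C * Real.exp (-b * R)) (fun y hy => ?_)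
    · simpa using this
    · rw [Set.uIoc_of_le (by norm_num)] at hy
      simpa using hF (R + y * Complex.I) (by simpa using hR) (by simpa using hy.1.le)
        (by simpa using hy.2)
  have hrect : ∀ R : ℝ, 0 ≤ R → (∫ x in (0 : ℝ)..R, F x) =
      (∫ x in (0 : ℝ)..R, F (x - Complex.I)) +
        Complex.I * (∫ y in (-1 : ℝ)..0, F (R + y * Complex.I)) -
        Complex.I * (∫ y in (-1 : ℝ)..0, F (y * Complex.I)) := by
    intro R hR
    -- Holomorphy is needed only inside the rectangle; continuity suffices at the corner 0, the
    -- branch point of z^a.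
    have := Complex.integral_boundary_rect_eq_zero_of_continuousOn_of_differentiableOn F
      (-Complex.I) (R : ℂ) (hc.mono ?_) (hd.mono ?_)
    · simp only [Complex.neg_re, Complex.neg_im, Complex.I_re, Complex.I_im, Complex.ofReal_re,
        Complex.ofReal_im, neg_zero, Complex.ofReal_zero, zero_mul, add_zero, zero_add,
        Complex.ofReal_neg, Complex.ofReal_one, neg_mul, one_mul, smul_eq_mul,
        ← sub_eq_add_neg] at this
      linear_combination -this
    · intro z hz
      rw [Complex.mem_reProdIm] at hz
      simp only [Complex.neg_re, Complex.neg_im, Complex.I_re, Complex.I_im, Complex.ofReal_re,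
        Complex.ofReal_im, neg_zero, Set.uIcc_of_le hR,
        Set.uIcc_of_le (show (-1 : ℝ) ≤ 0 by norm_num)] at hz
      exact ⟨hz.1.1, hz.2.1, hz.2.2⟩
    · intro z hz
      rw [Complex.mem_reProdIm] at hz
      simp only [Complex.neg_re, Complex.I_re, Complex.ofReal_re, neg_zero, min_eq_left hR] at hz
      exact hz.1.1
  have l3 := (l1.add (l2.const_mul Complex.I)).sub_const
    (Complex.I * (∫ y in (-1 : ℝ)..0, F (y * Complex.I)))
  have l4 := tendsto_nhds_unique (l3.congr' ?_) l0
  · rw [← l4]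
    have := intervalIntegral.integral_comp_neg (a := (0 : ℝ)) (b := 1)
      (fun y : ℝ => F (y * Complex.I))
    simp only [Complex.ofReal_neg, neg_mul, neg_zero] at this
    rw [this]
    ring
  · filter_upwards [Filter.eventually_ge_atTop 0] with R hR
    simpa using (hrect R hR).symm

/-- If `f (-t)` is the conjugate of `f t`, the integral of `f` over the line is twice the real part
of the integral over the half-line. -/
lemma re_integral_eq_two_mul_re_integral_Ioi {f : ℝ → ℂ} (hf : Integrable f)
    (h : ∀ t, f (-t) = (starRingEnd ℂ) (f t)) :
    (∫ t, f t).re = 2 * (∫ t in Set.Ioi (0 : ℝ), f t).re := by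
  have h1 := intervalIntegral.integral_Iic_add_Ioi (b := (0 : ℝ)) hf.integrableOn hf.integrableOn
  have h2 := integral_comp_neg_Ioi (0 : ℝ) f
  simp only [h, neg_zero] at h2
  rw [integral_conj] at h2
  rw [← h1, ← h2, Complex.add_re, Complex.conj_re]
  ring

/-- Real parts of powers in the half-strip below the positive real axis. -/
lemma strip_le_re_cpow_mul {a ζ : ℝ} (ha1 : 1 ≤ a) (ha2 : a ≤ 2) (hζ : |ζ| ≤ 1 / 2) {z : ℂ}
    (h0 : 0 ≤ z.re) (h1 : -1 ≤ z.im) (h2 : z.im ≤ 0) :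
    z.re / 12 - 10 ≤ (z ^ (a : ℂ) * (1 + ζ * Complex.I)).re := by
  have hn : ‖z ^ (a : ℂ)‖ = ‖z‖ ^ a := Complex.norm_cpow_real z a
  have hr0 : 0 ≤ ‖z‖ := norm_nonneg z
  have hre : (z ^ (a : ℂ) * (1 + ζ * Complex.I)).re
      = (z ^ (a : ℂ)).re - ζ * (z ^ (a : ℂ)).im := by
    simp [Complex.mul_re]; ring
  have him : |ζ * (z ^ (a : ℂ)).im| ≤ 1 / 2 * ‖z‖ ^ a := by
    rw [abs_mul, ← hn]
    exact mul_le_mul hζ (Complex.abs_im_le_norm _) (abs_nonneg _) (by norm_num)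
  have him' := (abs_le.1 him).2
  have hsq : ‖z‖ ^ 2 = z.re ^ 2 + z.im ^ 2 := by
    rw [Complex.sq_norm, Complex.normSq_apply]; ring
  rw [hre]
  rcases le_total z.re 2 with ht | ht
  · have hre' : -‖z‖ ^ a ≤ (z ^ (a : ℂ)).re := by
      rw [← hn]; exact (abs_le.1 (Complex.abs_re_le_norm _)).1
    have hz6 : ‖z‖ ^ a ≤ 6 := by
      rcases le_total ‖z‖ 1 with hz | hz
      · exact (Real.rpow_le_one hr0 hz (by linarith)).trans (by norm_num)
      · have : ‖z‖ ^ a ≤ ‖z‖ ^ (2 : ℝ) := Real.rpow_le_rpow_of_exponent_le hz ha2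
        rw [Real.rpow_two] at this
        nlinarith
    linarith
  · have hr1 : 1 ≤ ‖z‖ := by
      have := Complex.abs_re_le_norm z
      rw [abs_of_nonneg h0] at this
      linarith
    have hr : ‖z‖ ≤ z.re + 1 := by
      have := Complex.norm_le_abs_re_add_abs_im z
      rw [abs_of_nonneg h0, abs_of_nonpos h2] at this
      linarith
    -- Since a|arg z| ≤ 2|arg z| ≤ π, monotonicity of the cosine compares Re z^a with |z|^(a−2) Re
    -- z².
    have hcos : Real.cos (2 * z.arg) ≤ Real.cos (z.arg * a) := by
      rw [← Real.cos_abs (2 * z.arg), ← Real.cos_abs (z.arg * a)]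
      have harg := Complex.abs_arg_le_pi_div_two_iff.2 h0
      refine Real.cos_le_cos_of_nonneg_of_le_pi (abs_nonneg _) ?_ ?_
      · rw [abs_mul, abs_two]; linarith
      · rw [abs_mul, abs_mul, abs_two, abs_of_nonneg (by linarith : 0 ≤ a), mul_comm]
        exact mul_le_mul_of_nonneg_right ha2 (abs_nonneg _)
    have hpos : 0 < ‖z‖ := by linarith
    have hra : ‖z‖ ^ a = ‖z‖ ^ (a - 2) * ‖z‖ ^ 2 := by
      rw [← Real.rpow_two, ← Real.rpow_add hpos]; ring_nf
    have hcz : ‖z‖ ^ 2 * Real.cos (2 * z.arg) = z.re ^ 2 - z.im ^ 2 := by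
      have e1 := Complex.norm_mul_cos_arg z
      have e2 := Complex.norm_mul_sin_arg z
      rw [Real.cos_two_mul']
      rw [← e1, ← e2]
      ring
    have hlow : ‖z‖ ^ (a - 2) * (z.re ^ 2 - z.im ^ 2) ≤ (z ^ (a : ℂ)).re := by
      rw [Complex.cpow_ofReal_re, hra, ← hcz, ← mul_assoc]
      exact mul_le_mul_of_nonneg_left hcos (by positivity)
    have hq : 1 / ‖z‖ ≤ ‖z‖ ^ (a - 2) := by
      rw [one_div, ← Real.rpow_neg_one]
      exact Real.rpow_le_rpow_of_exponent_le hr1 (by linarith)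
    have hy : z.im ^ 2 ≤ 1 := by nlinarith
    -- The bound x²/2 − 3/2 ≥ x²/8 holds from x = 2 on, which fixes the case split. With |z| ≤ x + 1
    -- ≤ 3x/2 it leaves (x²/8)/(3x/2) = x/12.
    have hfin : z.re / 12 ≤ ‖z‖ ^ (a - 2) * (z.re ^ 2 / 2 - 3 / 2 * z.im ^ 2) := by
      have e1 : z.re ^ 2 / 8 ≤ z.re ^ 2 / 2 - 3 / 2 * z.im ^ 2 := by nlinarith
      calc z.re / 12 ≤ 1 / ‖z‖ * (z.re ^ 2 / 8) := by
            rw [one_div, ← div_eq_inv_mul, le_div_iff₀ hpos]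
            nlinarith
        _ ≤ _ := mul_le_mul hq e1 (by positivity) (by positivity)
    have : ‖z‖ ^ (a - 2) * (z.re ^ 2 / 2 - 3 / 2 * z.im ^ 2) =
        ‖z‖ ^ (a - 2) * (z.re ^ 2 - z.im ^ 2) - 1 / 2 * ‖z‖ ^ a := by
      rw [hra, hsq]; ring
    linarith

/-! ### Fourier representation of the density and its derivatives -/

noncomputable section

/-- The integrand of the `k`-th derivative of a centred stable density in Fourier form, as a
function of a complex frequency in the right half-plane. -/
def stableKernel (k : ℕ) (a ζ y : ℝ) (z : ℂ) : ℂ :=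
  (-(Complex.I * z)) ^ k *
    Complex.exp (-(Complex.I * z * y) - z ^ (a : ℂ) * (1 + ζ * Complex.I))

/-- The `k`-th derivative of a centred stable density as an integral over positive frequencies. -/
def stableHalfLine (k : ℕ) (a ζ y : ℝ) : ℝ :=
  1 / Real.pi * (∫ t in Set.Ioi (0 : ℝ), stableKernel k a ζ y t).re

lemma exists_norm_exp_strip_le :
    ∃ C : ℝ, 0 < C ∧ ∀ a ζ : ℝ, 1 ≤ a → a ≤ 2 → |ζ| ≤ 1 / 2 → ∀ z : ℂ, 0 ≤ z.re → -1 ≤ z.im →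
      z.im ≤ 0 → ‖Complex.exp (-(z ^ (a : ℂ) * (1 + ζ * Complex.I)))‖
        ≤ C * Real.exp (-(1 / 12) * z.re) := by
  refine ⟨Real.exp 10, Real.exp_pos _, fun a ζ h1 h2 h3 z h4 h5 h6 => ?_⟩
  rw [Complex.norm_exp, ← Real.exp_add]
  refine Real.exp_le_exp.2 ?_
  have := strip_le_re_cpow_mul h1 h2 h3 h4 h5 h6
  rw [Complex.neg_re]
  linarith

/-- Polynomial factors are paid for with half of the decay rate, 1/12 becoming 1/24. -/
lemma exists_add_two_pow_mul_exp_le (n : ℕ) :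
    ∃ C : ℝ, 0 < C ∧ ∀ t : ℝ, 0 ≤ t →
      (t + 2) ^ n * Real.exp (-(1 / 12) * t) ≤ C * Real.exp (-(1 / 24) * t) := by
  refine ⟨n.factorial * 24 ^ n * Real.exp (1 / 12), by positivity, fun t ht => ?_⟩
  have h := Real.pow_div_factorial_le_exp ((t + 2) / 24) (by positivity) n
  rw [div_pow, div_div, div_le_iff₀ (by positivity)] at h
  calc (t + 2) ^ n * Real.exp (-(1 / 12) * t)
      ≤ (Real.exp ((t + 2) / 24) * (24 ^ n * n.factorial)) * Real.exp (-(1 / 12) * t) := by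
        gcongr
    _ = n.factorial * 24 ^ n * (Real.exp ((t + 2) / 24) * Real.exp (-(1 / 12) * t)) := by ring
    _ = _ := by
        rw [mul_assoc _ (Real.exp (1 / 12)), ← Real.exp_add, ← Real.exp_add]
        congr 2
        ring

lemma norm_le_re_add_two {z : ℂ} (h0 : 0 ≤ z.re) (h1 : -1 ≤ z.im) (h2 : z.im ≤ 0) :
    ‖z‖ ≤ z.re + 2 := by
  have := Complex.norm_le_abs_re_add_abs_im z
  rw [abs_of_nonneg h0, abs_of_nonpos h2] at this
  linarith

lemma stableKernel_eq_mul (k : ℕ) (a ζ y : ℝ) (z : ℂ) :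
    stableKernel k a ζ y z = (-(Complex.I * z)) ^ k * Complex.exp (-(Complex.I * z * y)) *
      Complex.exp (-(z ^ (a : ℂ) * (1 + ζ * Complex.I))) := by
  rw [stableKernel, sub_eq_add_neg, Complex.exp_add]
  ring

lemma norm_neg_I_mul_pow_mul_exp (k : ℕ) (y : ℝ) (z : ℂ) :
    ‖(-(Complex.I * z)) ^ k * Complex.exp (-(Complex.I * z * y))‖ =
      ‖z‖ ^ k * Real.exp (y * z.im) := by
  rw [norm_mul, norm_pow, norm_neg, norm_mul, Complex.norm_I, one_mul, Complex.norm_exp]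
  congr 2
  simp [Complex.mul_re]
  ring

/-- The factor exp(y Im z) is kept apart: it is 1 on the real axis, at most 1 in the strip when y ≥
0, and e^(−y) on the shifted line. The constant is uniform in a, ζ and y. -/
lemma exists_norm_stableKernel_le (k : ℕ) :
    ∃ C : ℝ, 0 < C ∧ ∀ a ζ y : ℝ, 1 ≤ a → a ≤ 2 → |ζ| ≤ 1 / 2 → ∀ z : ℂ, 0 ≤ z.re →
      -1 ≤ z.im → z.im ≤ 0 →
      ‖stableKernel k a ζ y z‖ ≤ Real.exp (y * z.im) * (C * Real.exp (-(1 / 24) * z.re)) := by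
  obtain ⟨C, hC, h⟩ := exists_norm_exp_strip_le
  obtain ⟨C', hC', h'⟩ := exists_add_two_pow_mul_exp_le k
  refine ⟨C * C', by positivity, fun a ζ y h1 h2 h3 z h4 h5 h6 => ?_⟩
  rw [stableKernel_eq_mul, norm_mul, norm_neg_I_mul_pow_mul_exp]
  calc ‖z‖ ^ k * Real.exp (y * z.im) *
        ‖Complex.exp (-(z ^ (a : ℂ) * (1 + ζ * Complex.I)))‖
      ≤ (z.re + 2) ^ k * Real.exp (y * z.im) * (C * Real.exp (-(1 / 12) * z.re)) := by
        gcongr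
        · exact norm_le_re_add_two h4 h5 h6
        · exact h a ζ h1 h2 h3 z h4 h5 h6
    _ = Real.exp (y * z.im) * C * ((z.re + 2) ^ k * Real.exp (-(1 / 12) * z.re)) := by ring
    _ ≤ Real.exp (y * z.im) * C * (C' * Real.exp (-(1 / 24) * z.re)) := by
        exact mul_le_mul_of_nonneg_left (h' _ h4) (by positivity)
    _ = _ := by ring

lemma continuousOn_stableKernel (k : ℕ) {a : ℝ} (ha : 0 < a) (ζ y : ℝ) :
    ContinuousOn (stableKernel k a ζ y) {z | 0 ≤ z.re} := by
  intro z hz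
  have hp : ContinuousAt (fun z : ℂ => z ^ (a : ℂ)) z := by
    -- The origin is the only point of the closed right half-plane on the branch cut; there Re a > 0
    -- gives continuity.
    by_cases h : z = 0
    · rw [h]
      have := Complex.continuousAt_cpow_zero_of_re_pos (z := (a : ℂ)) (by simpa using ha)
      exact ContinuousAt.comp (f := fun w : ℂ => (w, (a : ℂ))) (x := (0 : ℂ)) this (by fun_prop)
    · refine continuousAt_cpow_const (Complex.mem_slitPlane_iff.2 ?_)
      by_contra! hn
      exact h (Complex.ext (le_antisymm hn.1 hz) hn.2)
  unfold stableKernel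
  refine ContinuousAt.continuousWithinAt ?_
  fun_prop

lemma differentiableOn_stableKernel (k : ℕ) (a ζ y : ℝ) :
    DifferentiableOn ℂ (stableKernel k a ζ y) {z | 0 < z.re} := by
  intro z hz
  have hp : DifferentiableAt ℂ (fun z : ℂ => z ^ (a : ℂ)) z :=
    differentiableAt_id.cpow_const (Or.inl hz)
  unfold stableKernel
  refine DifferentiableAt.differentiableWithinAt ?_
  fun_prop

lemma continuousOn_stableKernel_ofReal (k : ℕ) {a : ℝ} (ha : 0 < a) (ζ y : ℝ) :
    ContinuousOn (fun t : ℝ => stableKernel k a ζ y t) (Set.Ioi 0) :=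
  (continuousOn_stableKernel k ha ζ y).comp (by fun_prop) fun t ht => by
    simpa using (Set.mem_Ioi.1 ht).le

lemma integrableOn_exp_neg_div (C : ℝ) :
    IntegrableOn (fun t : ℝ => C * Real.exp (-(1 / 24) * t)) (Set.Ioi 0) :=
  (integrableOn_exp_mul_Ioi (by norm_num) 0).const_mul C

lemma exists_norm_stableKernel_ofReal_le (k : ℕ) :
    ∃ C : ℝ, 0 < C ∧ ∀ a ζ y : ℝ, 1 ≤ a → a ≤ 2 → |ζ| ≤ 1 / 2 → ∀ t : ℝ, 0 < t →
      ‖stableKernel k a ζ y t‖ ≤ C * Real.exp (-(1 / 24) * t) := by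
  obtain ⟨C, hC, h⟩ := exists_norm_stableKernel_le k
  refine ⟨C, hC, fun a ζ y h1 h2 h3 t ht => ?_⟩
  simpa using h a ζ y h1 h2 h3 t (by simpa using ht.le) (by simp) (by simp)

lemma integrableOn_stableKernel (k : ℕ) {a ζ : ℝ} (y : ℝ) (h1 : 1 ≤ a) (h2 : a ≤ 2)
    (h3 : |ζ| ≤ 1 / 2) :
    IntegrableOn (fun t : ℝ => stableKernel k a ζ y t) (Set.Ioi 0) := by
  obtain ⟨C, hC, h⟩ := exists_norm_stableKernel_ofReal_le k
  refine Integrable.mono' (integrableOn_exp_neg_div C)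
    ((continuousOn_stableKernel_ofReal k (by linarith) ζ y).aestronglyMeasurable
      measurableSet_Ioi) ?_
  exact (ae_restrict_iff' measurableSet_Ioi).2
    (Filter.Eventually.of_forall fun t ht => h a ζ y h1 h2 h3 t ht)

lemma hasDerivAt_stableHalfLine (k : ℕ) {a ζ : ℝ} (y : ℝ) (h1 : 1 ≤ a) (h2 : a ≤ 2)
    (h3 : |ζ| ≤ 1 / 2) :
    HasDerivAt (stableHalfLine k a ζ) (stableHalfLine (k + 1) a ζ y) y := by
  obtain ⟨C, hC, h⟩ := exists_norm_stableKernel_ofReal_le (k + 1)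
  have key := hasDerivAt_integral_of_dominated_loc_of_deriv_le
    (μ := volume.restrict (Set.Ioi (0 : ℝ))) (s := Set.univ) (x₀ := y)
    (F := fun y t => stableKernel k a ζ y (t : ℂ))
    (F' := fun y t => stableKernel (k + 1) a ζ y (t : ℂ))
    (bound := fun t => C * Real.exp (-(1 / 24) * t)) Filter.univ_mem
    (Filter.Eventually.of_forall fun y =>
      (continuousOn_stableKernel_ofReal k (by linarith) ζ y).aestronglyMeasurable
        measurableSet_Ioi)
    (integrableOn_stableKernel k y h1 h2 h3)
    ((continuousOn_stableKernel_ofReal (k + 1) (by linarith) ζ y).aestronglyMeasurable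
        measurableSet_Ioi)
    ((ae_restrict_iff' measurableSet_Ioi).2
      (Filter.Eventually.of_forall fun t ht y _ => h a ζ y h1 h2 h3 t ht))
    (integrableOn_exp_neg_div C)
    (Filter.Eventually.of_forall fun t y _ => ?_)
  · have hre := (Complex.reCLM.hasFDerivAt.comp_hasDerivAt y key.2).const_mul (1 / Real.pi)
    exact hre
  · have e1 : HasDerivAt (fun y : ℝ => -(Complex.I * t * (y : ℂ))
        - (t : ℂ) ^ (a : ℂ) * (1 + ζ * Complex.I)) (-(Complex.I * t)) y := by
      have := ((Complex.ofRealCLM.hasDerivAt (x := y)).const_mul (-(Complex.I * t))).sub_const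
        ((t : ℂ) ^ (a : ℂ) * (1 + ζ * Complex.I))
      simpa using this
    have e2 := e1.cexp.const_mul ((-(Complex.I * t)) ^ k)
    refine e2.congr_deriv ?_
    rw [stableKernel, pow_succ]
    ring

lemma conj_cpow_ofReal {z : ℂ} (hz : 0 < z.re) (a : ℝ) :
    (starRingEnd ℂ) (z ^ (a : ℂ)) = (starRingEnd ℂ z) ^ (a : ℂ) := by
  have : z.arg ≠ Real.pi := fun h => by
    have := (Complex.arg_eq_pi_iff.1 h).1
    linarith
  rw [Complex.conj_cpow _ _ this, Complex.conj_ofReal]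

/-- Conjugating the kernel reverses y and ζ. The downward contour shift requires y ≥ 0, and this
reflection supplies the other half-line. -/
lemma stableHalfLine_neg (k : ℕ) (a ζ y : ℝ) :
    stableHalfLine k a ζ (-y) = (-1) ^ k * stableHalfLine k a (-ζ) y := by
  have : (∫ t in Set.Ioi (0 : ℝ), stableKernel k a ζ (-y) t) =
      (starRingEnd ℂ) ((-1) ^ k * ∫ t in Set.Ioi (0 : ℝ), stableKernel k a (-ζ) y t) := by
    rw [← integral_const_mul, ← integral_conj]
    refine setIntegral_congr_fun measurableSet_Ioi fun t ht => ?_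
    have hc := conj_cpow_ofReal (z := (t : ℂ)) (by simpa using ht) a
    rw [Complex.conj_ofReal] at hc
    simp only [stableKernel, map_mul, map_pow, map_neg, map_one, ← Complex.exp_conj, map_sub,
      Complex.conj_I, Complex.conj_ofReal, hc, map_add, Complex.ofReal_neg]
    rw [← mul_assoc, ← mul_pow]
    congr 2 <;> ring_nf
  rw [stableHalfLine, stableHalfLine, this, Complex.conj_re]
  have h2 : ((-1 : ℂ) ^ k) = (((-1 : ℝ) ^ k : ℝ) : ℂ) := by push_cast; rfl
  rw [h2, Complex.re_ofReal_mul]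
  ring

lemma stableHalfLine_two_zero_eq (y : ℝ) :
    stableHalfLine 0 2 0 y = normalDensityTwo y := by
  have hi : Integrable (fun t : ℝ => Complex.exp (Complex.I * ((-y : ℝ) : ℂ) * t) *
      Complex.exp (-(1 : ℂ) * (t : ℂ) ^ 2)) := by
    have hg : Integrable (fun t : ℝ => Real.exp (-1 * t ^ 2)) :=
      integrable_exp_neg_mul_sq one_pos
    refine hg.mono' (by fun_prop) (Filter.Eventually.of_forall fun t => ?_)
    rw [norm_mul, Complex.norm_exp, Complex.norm_exp]
    simp [← Complex.ofReal_pow]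
  have h1 := re_integral_eq_two_mul_re_integral_Ioi hi fun t => by
    simp only [map_mul, ← Complex.exp_conj, map_neg, map_pow, map_one, Complex.conj_I,
      Complex.conj_ofReal, Complex.ofReal_neg]
    congr 2 <;> ring
  have h2 : (∫ t in Set.Ioi (0 : ℝ), stableKernel 0 2 0 y t) =
      ∫ t in Set.Ioi (0 : ℝ), Complex.exp (Complex.I * ((-y : ℝ) : ℂ) * t) *
        Complex.exp (-(1 : ℂ) * (t : ℂ) ^ 2) := by
    refine setIntegral_congr_fun measurableSet_Ioi fun t ht => ?_
    simp only [stableKernel, pow_zero, one_mul, ← Complex.exp_add]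
    congr 1
    push_cast
    rw [← Complex.cpow_natCast]
    push_cast
    ring
  have h3 := fourierIntegral_gaussian (b := 1) (by simp) ((-y : ℝ) : ℂ)
  rw [stableHalfLine, h2]
  rw [h3] at h1
  have h4 : ((Real.pi / 1 : ℂ) ^ (1 / 2 : ℂ) * Complex.exp (-((-y : ℝ) : ℂ) ^ 2 / (4 * 1))) =
      ((Real.sqrt Real.pi * Real.exp (-y ^ 2 / 4) : ℝ) : ℂ) := by
    rw [Real.sqrt_eq_rpow, div_one]
    push_cast
    rw [Complex.ofReal_cpow Real.pi_pos.le]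
    push_cast
    ring_nf
  rw [h4, Complex.ofReal_re] at h1
  have h5 : (∫ t in Set.Ioi (0 : ℝ), Complex.exp (Complex.I * ((-y : ℝ) : ℂ) * t) *
        Complex.exp (-(1 : ℂ) * (t : ℂ) ^ 2)).re =
        Real.sqrt Real.pi * Real.exp (-y ^ 2 / 4) / 2 := by linarith
  rw [h5, normalDensityTwo]
  have hs : Real.sqrt Real.pi ≠ 0 := by positivity
  have hp : Real.pi = Real.sqrt Real.pi * Real.sqrt Real.pi :=
    (Real.mul_self_sqrt Real.pi_pos.le).symm
  field_simp
  rw [pow_two, ← hp]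

lemma hasDerivAt_normalDensityTwo (y : ℝ) :
    HasDerivAt normalDensityTwo (-(y / 2) * normalDensityTwo y) y := by
  have h : HasDerivAt (fun y : ℝ => -y ^ 2 / 4) (-(2 * y) / 4) y := by
    simpa using ((hasDerivAt_pow 2 y).neg).div_const 4
  refine (h.exp.const_mul (1 / (2 * Real.sqrt Real.pi))).congr_deriv ?_
  rw [normalDensityTwo]
  ring

lemma stableHalfLine_one_two_zero_eq (y : ℝ) :
    stableHalfLine 1 2 0 y = -(y / 2) * normalDensityTwo y := by
  have h := hasDerivAt_stableHalfLine 0 (a := 2) (ζ := 0) y (by norm_num) le_rfl (by norm_num)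
  rw [funext stableHalfLine_two_zero_eq] at h
  exact h.unique (hasDerivAt_normalDensityTwo y)

/-- The integrand is Hermitian in t, so positive frequencies suffice. There the term t^a · t^(1−a) =
t of the (M) parameterization only translates x by ζ. -/
lemma stableDensity_eq_stableHalfLine {a β : ℝ} (μ x : ℝ) (h1 : 1 ≤ a)
    (h2 : a ≤ 2) (h3 : |stableShift a β| ≤ 1 / 2) :
    stableDensity μ 1 a β x =
      stableHalfLine 0 a (stableShift a β) (x - stableShift a β - μ) := by
  have hconj : ∀ t : ℝ, Complex.exp (-(Complex.I * ((-t * x : ℝ) : ℂ))) * stableCF μ 1 a β (-t) =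
      (starRingEnd ℂ) (Complex.exp (-(Complex.I * ((t * x : ℝ) : ℂ))) * stableCF μ 1 a β t) := by
    intro t
    simp only [stableCF, map_mul, ← Complex.exp_conj, map_neg, map_add, map_one, Complex.conj_I,
      Complex.conj_ofReal, Real.sign_neg, one_mul, abs_neg]
    congr 2 <;> push_cast <;> ring
  have hker : ∀ t : ℝ, 0 < t →
      Complex.exp (-(Complex.I * ((t * x : ℝ) : ℂ))) * stableCF μ 1 a β t =
        stableKernel 0 a (stableShift a β) (x - stableShift a β - μ) t := by
    intro t ht
    have e : t ^ a * t ^ (1 - a) = t := by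
      rw [← Real.rpow_add ht]; simp
    have e' : ((t ^ a : ℝ) : ℂ) * ((t ^ (1 - a) : ℝ) : ℂ) = t := by exact_mod_cast e
    rw [stableCF, stableKernel, pow_zero, one_mul, ← Complex.exp_add, Real.sign_of_pos ht, one_mul,
      abs_of_pos ht, ← Complex.ofReal_cpow ht.le]
    simp only [stableShift]
    congr 1
    push_cast
    linear_combination (-(Complex.I * β * Complex.tan (Real.pi * a / 2))) * e'
  have hint : Integrable (fun t : ℝ =>
      Complex.exp (-(Complex.I * ((t * x : ℝ) : ℂ))) * stableCF μ 1 a β t) := by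
    have hr : IntegrableOn (fun t : ℝ =>
        Complex.exp (-(Complex.I * ((t * x : ℝ) : ℂ))) * stableCF μ 1 a β t) (Set.Ioi 0) :=
      (integrableOn_stableKernel 0 (x - stableShift a β - μ) h1 h2 h3).congr_fun
        (fun t ht => (hker t ht).symm) measurableSet_Ioi
    have hl : IntegrableOn (fun t : ℝ =>
        Complex.exp (-(Complex.I * ((t * x : ℝ) : ℂ))) * stableCF μ 1 a β t) (Set.Iic 0) := by
      have hc : IntegrableOn (fun t : ℝ => (starRingEnd ℂ)
          (Complex.exp (-(Complex.I * ((t * x : ℝ) : ℂ))) * stableCF μ 1 a β t)) (Set.Ioi 0) :=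
        (LinearIsometryEquiv.integrable_comp_iff Complex.conjLIE).2 hr
      simp only [← hconj] at hc
      have hc' := (integrableOn_Ici_iff_integrableOn_Ioi (b := (0 : ℝ))).2 hc
      rw [← neg_zero] at hc'
      simpa only [neg_neg] using hc'.comp_neg_Iic
    rw [← integrableOn_univ, ← Set.Iic_union_Ioi (a := (0 : ℝ))]
    exact hl.union hr
  rw [stableDensity, re_integral_eq_two_mul_re_integral_Ioi hint hconj, stableHalfLine,
    setIntegral_congr_fun measurableSet_Ioi fun t ht => hker t ht]
  have := Real.pi_ne_zero
  field_simp

lemma stableDensityMu_eq_stableHalfLine {a β : ℝ} (x : ℝ) (h1 : 1 ≤ a)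
    (h2 : a ≤ 2) (h3 : |stableShift a β| ≤ 1 / 2) :
    stableDensityMu a β x =
      -stableHalfLine 1 a (stableShift a β) (x - stableShift a β) := by
  rw [stableDensityMu]
  simp only [stableDensity_eq_stableHalfLine _ x h1 h2 h3]
  have h := hasDerivAt_stableHalfLine 0 (a := a) (ζ := stableShift a β)
    (x - stableShift a β - 0) h1 h2 h3
  have := h.scomp (0 : ℝ) ((hasDerivAt_id (0 : ℝ)).const_sub (x - stableShift a β))
  rw [sub_zero] at this
  exact this.deriv.trans (by simp)

end

/-! ### Contour shift: vertical segment and shifted half-line -/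

noncomputable section

/-- The contribution of the vertical segment from `0` to `-i`. -/
def stableVertical (k : ℕ) (a ζ y : ℝ) : ℝ :=
  1 / Real.pi * ∫ s in Set.Ioc (0 : ℝ) 1, (-s) ^ k * Real.exp (-(s * y)) *
    (Real.exp (s ^ a * -(Real.cos (Real.pi * a / 2) + ζ * Real.sin (Real.pi * a / 2))) *
      Real.sin (s ^ a * (Real.sin (Real.pi * a / 2) - ζ * Real.cos (Real.pi * a / 2))))

lemma neg_mul_I_cpow {s : ℝ} (hs : 0 < s) (a : ℝ) :
    (-(s * Complex.I)) ^ (a : ℂ) = ((s ^ a : ℝ) : ℂ) *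
      ((Real.cos (Real.pi * a / 2) : ℂ) - Real.sin (Real.pi * a / 2) * Complex.I) := by
  have h1 : -((s : ℂ) * Complex.I) = (s : ℂ) * (-Complex.I) := by ring
  have h2 : (s : ℂ) ≠ 0 := by exact_mod_cast hs.ne'
  have h3 : (-(Real.pi / 2) * Complex.I * a : ℂ) = ((-(Real.pi * a / 2) : ℝ) : ℂ) * Complex.I := by
    push_cast; ring
  rw [h1, Complex.cpow_def_of_ne_zero (by simp [h2]), Complex.log_ofReal_mul hs (by simp),
    Complex.log_neg_I, add_mul, Complex.exp_add, h3, Complex.exp_mul_I, ← Complex.ofReal_cos,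
    ← Complex.ofReal_sin, Real.cos_neg, Real.sin_neg, Real.rpow_def_of_pos hs]
  push_cast
  ring

/-- The segment is traversed with dz = −i ds, so the real part of its integral is the integral of
the imaginary part of the kernel. -/
lemma im_stableKernel_neg_mul_I (k : ℕ) (a ζ y : ℝ) {s : ℝ} (hs : 0 < s) :
    (stableKernel k a ζ y (-(s * Complex.I))).im = (-s) ^ k * Real.exp (-(s * y)) *
    (Real.exp (s ^ a * -(Real.cos (Real.pi * a / 2) + ζ * Real.sin (Real.pi * a / 2))) *
      Real.sin (s ^ a * (Real.sin (Real.pi * a / 2) - ζ * Real.cos (Real.pi * a / 2)))) := by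
  have h1 : -(Complex.I * -((s : ℂ) * Complex.I)) = ((-s : ℝ) : ℂ) := by
    push_cast
    linear_combination (s : ℂ) * Complex.I_mul_I
  have h2 : -(Complex.I * -((s : ℂ) * Complex.I) * (y : ℂ)) = ((-(s * y) : ℝ) : ℂ) := by
    rw [← neg_mul, h1]; push_cast; ring
  rw [stableKernel_eq_mul, h1, h2, ← Complex.ofReal_exp, ← Complex.ofReal_pow,
    ← Complex.ofReal_mul, Complex.im_ofReal_mul, Complex.exp_im, neg_mul_I_cpow hs]
  generalize Real.cos (Real.pi * a / 2) = c, Real.sin (Real.pi * a / 2) = d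
  congr 3
  · simp [Complex.mul_re, Complex.mul_im]
    ring
  · simp [Complex.mul_re, Complex.mul_im]
    ring

lemma stableHalfLine_eq_vertical_add (k : ℕ) {a ζ y : ℝ} (h1 : 1 ≤ a) (h2 : a ≤ 2)
    (h3 : |ζ| ≤ 1 / 2) (hy : 0 ≤ y) :
    stableHalfLine k a ζ y = stableVertical k a ζ y +
      1 / Real.pi * (∫ t in Set.Ioi (0 : ℝ), stableKernel k a ζ y (t - Complex.I)).re := by
  obtain ⟨C, hC, h⟩ := exists_norm_stableKernel_le k
  have hcont := continuousOn_stableKernel k (by linarith : 0 < a) ζ y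
  have hshift := integral_Ioi_eq_vertical_add_shifted (F := stableKernel k a ζ y) (C := C)
    (b := 1 / 24) (by norm_num) (hcont.mono fun z hz => hz.1)
    (differentiableOn_stableKernel k a ζ y) fun z h4 h5 h6 => by
      refine (h a ζ y h1 h2 h3 z h4 h5 h6).trans ?_
      refine mul_le_of_le_one_left (by positivity) ?_
      exact Real.exp_le_one_iff.2 (mul_nonpos_of_nonneg_of_nonpos hy h6)
  have hi : IntegrableOn (fun s : ℝ => stableKernel k a ζ y (-(s * Complex.I)))
      (Set.Ioc 0 1) := by
    refine (ContinuousOn.integrableOn_Icc ?_).mono_set Set.Ioc_subset_Icc_self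
    exact hcont.comp (by fun_prop) fun t ht => by simp
  have him := integral_im hi
  simp only [RCLike.im_eq_complex_im] at him
  rw [stableHalfLine, hshift, Complex.add_re, mul_add, stableVertical,
    intervalIntegral.integral_of_le zero_le_one]
  congr 2
  rw [← setIntegral_congr_fun measurableSet_Ioc
    fun s hs => im_stableKernel_neg_mul_I k a ζ y hs.1, him]
  simp

/-- Here sin π = 0 and ζ = 0: the Gaussian has no power tail, so the segment belongs wholly to the
stable correction. -/
lemma stableVertical_two_zero (k : ℕ) (y : ℝ) : stableVertical k 2 0 y = 0 := by
  simp [stableVertical]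

/-- On Im z = −1 one has |z| ≥ 1, so log z grows at most linearly in t and |z^(a−2)| ≤ 1. The factor
2 − a comes from z^(a−2) − 1 and from the bound on ζ. -/
lemma norm_sub_I_cpow_sub_le {a ζ : ℝ} (h2 : a ≤ 2) (hζ : |ζ| ≤ 2 * (2 - a)) {t : ℝ}
    (ht : 0 ≤ t) :
    ‖(t - Complex.I) ^ (a : ℂ) * (1 + ζ * Complex.I) -
      (t - Complex.I) ^ ((2 : ℝ) : ℂ) * (1 + ((0 : ℝ) : ℂ) * Complex.I)‖
      ≤ 4 * (2 - a) * (t + 2) ^ 3 := by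
  set z : ℂ := t - Complex.I with hz
  have hre : z.re = t := by simp [hz]
  have him : z.im = -1 := by simp [hz]
  have hz0 : z ≠ 0 := fun h => by simp [h] at him
  have hn1 : 1 ≤ ‖z‖ := by
    have := Complex.abs_im_le_norm z
    rwa [him, abs_neg, abs_one] at this
  have hn2 : ‖z‖ ≤ t + 2 := by
    have := norm_le_re_add_two (z := z) (by rw [hre]; exact ht) (by rw [him]) (by rw [him]; norm_num)
    rwa [hre] at this
  have hlog0 : 0 ≤ Real.log ‖z‖ := Real.log_nonneg hn1
  have hlog : ‖Complex.log z‖ ≤ t + 6 := by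
    refine (Complex.norm_le_abs_re_add_abs_im _).trans ?_
    rw [Complex.log_re, Complex.log_im, abs_of_nonneg hlog0]
    have e1 := Real.log_le_sub_one_of_pos (by linarith : 0 < ‖z‖)
    have e2 := Complex.abs_arg_le_pi z
    have e3 := Real.pi_lt_four
    linarith
  have hpow : ‖z ^ ((a - 2 : ℝ) : ℂ)‖ ≤ 1 := by
    rw [Complex.norm_cpow_real]
    exact Real.rpow_le_one_of_one_le_of_nonpos hn1 (by linarith)
  have hsub : ‖z ^ ((a - 2 : ℝ) : ℂ) - 1‖ ≤ (2 - a) * (t + 6) := by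
    rw [Complex.cpow_def_of_ne_zero hz0, ← Complex.exp_zero]
    have hneg : (Complex.log z * ((a - 2 : ℝ) : ℂ)).re ≤ 0 := by
      rw [Complex.re_mul_ofReal, Complex.log_re]
      exact mul_nonpos_of_nonneg_of_nonpos hlog0 (by linarith)
    refine (norm_exp_sub_exp_le_of_re_le hneg (by simp)).trans ?_
    rw [Real.exp_zero, one_mul, sub_zero, norm_mul, Complex.norm_real, Real.norm_eq_abs,
      abs_of_nonpos (by linarith : a - 2 ≤ 0), mul_comm]
    have : 0 ≤ 2 - a := by linarith
    rw [neg_sub]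
    gcongr
  have hfac : z ^ (a : ℂ) * (1 + ζ * Complex.I) - z ^ ((2 : ℝ) : ℂ) * (1 + ((0 : ℝ) : ℂ) * Complex.I)
      = z ^ 2 * ((z ^ ((a - 2 : ℝ) : ℂ) - 1) + z ^ ((a - 2 : ℝ) : ℂ) * (ζ * Complex.I)) := by
    have e1 : z ^ ((2 : ℝ) : ℂ) = z ^ 2 := by
      rw [← Complex.cpow_natCast]; push_cast; rfl
    have e2 : z ^ (a : ℂ) = z ^ 2 * z ^ ((a - 2 : ℝ) : ℂ) := by
      rw [← e1, ← Complex.cpow_add _ _ hz0]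
      congr 1
      push_cast
      ring
    rw [e1, e2]
    push_cast
    ring
  rw [hfac, norm_mul, norm_pow]
  have hsum : ‖(z ^ ((a - 2 : ℝ) : ℂ) - 1) + z ^ ((a - 2 : ℝ) : ℂ) * (ζ * Complex.I)‖ ≤
      (2 - a) * (t + 6) + 2 * (2 - a) := by
    refine (norm_add_le _ _).trans (add_le_add hsub ?_)
    rw [norm_mul, norm_mul, Complex.norm_I, mul_one, Complex.norm_real, Real.norm_eq_abs]
    exact (mul_le_of_le_one_left (abs_nonneg _) hpow).trans hζ
  have ha : 0 ≤ 2 - a := by linarith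
  calc ‖z‖ ^ 2 * ‖(z ^ ((a - 2 : ℝ) : ℂ) - 1) + z ^ ((a - 2 : ℝ) : ℂ) * (ζ * Complex.I)‖
      ≤ (t + 2) ^ 2 * ((2 - a) * (t + 6) + 2 * (2 - a)) := by gcongr
    _ ≤ (t + 2) ^ 2 * (4 * (2 - a) * (t + 2)) := by
        gcongr
        nlinarith
    _ = _ := by ring

/-- Up to an exponentially small error of order `2 - a`, the difference between the stable and the
Gaussian case comes from the vertical segment. -/
lemma exists_abs_stableHalfLine_sub_le (k : ℕ) :
    ∃ C : ℝ, 0 < C ∧ ∀ a ζ y : ℝ, 1 ≤ a → a ≤ 2 → |ζ| ≤ 1 / 2 → |ζ| ≤ 2 * (2 - a) → 0 ≤ y →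
      |stableHalfLine k a ζ y - stableHalfLine k 2 0 y - stableVertical k a ζ y|
        ≤ C * (2 - a) * Real.exp (-y) := by
  -- The power k comes from (−iz)^k and 3 from `norm_sub_I_cpow_sub_le`; the factor 24 below is ∫₀^∞
  -- e^(−t/24) dt.
  obtain ⟨C, hC, h⟩ := exists_add_two_pow_mul_exp_le (k + 3)
  refine ⟨1 / Real.pi * (4 * Real.exp 10 * C * 24), by positivity,
    fun a ζ y h1 h2 h3 h4 hy => ?_⟩
  have ha : 0 ≤ 2 - a := by linarith
  rw [stableHalfLine_eq_vertical_add k h1 h2 h3 hy,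
    stableHalfLine_eq_vertical_add k (a := 2) (ζ := 0) (by norm_num) le_rfl (by norm_num) hy,
    stableVertical_two_zero]
  have hint : ∀ b ξ : ℝ, 1 ≤ b → b ≤ 2 → |ξ| ≤ 1 / 2 →
      IntegrableOn (fun t : ℝ => stableKernel k b ξ y (t - Complex.I)) (Set.Ioi 0) := by
    intro b ξ hb1 hb2 hξ
    obtain ⟨C', hC', h'⟩ := exists_norm_stableKernel_le k
    refine Integrable.mono' (integrableOn_exp_neg_div C') (ContinuousOn.aestronglyMeasurable
      ((continuousOn_stableKernel k (by linarith) ξ y).comp (by fun_prop) fun t ht => ?_)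
      measurableSet_Ioi) ?_
    · simpa using (Set.mem_Ioi.1 ht).le
    · refine (ae_restrict_iff' measurableSet_Ioi).2 (Filter.Eventually.of_forall fun t ht => ?_)
      have := h' b ξ y hb1 hb2 hξ (t - Complex.I) (by simpa using (Set.mem_Ioi.1 ht).le)
        (by simp) (by simp)
      refine this.trans ?_
      simp only [Complex.sub_re, Complex.ofReal_re, Complex.I_re, sub_zero]
      exact mul_le_of_le_one_left (by positivity) (by simpa using hy)
  have hdiff : ‖(∫ t in Set.Ioi (0 : ℝ), stableKernel k a ζ y (t - Complex.I)) -
      ∫ t in Set.Ioi (0 : ℝ), stableKernel k 2 0 y (t - Complex.I)‖ ≤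
      4 * Real.exp 10 * C * 24 * (2 - a) * Real.exp (-y) := by
    rw [← integral_sub (hint a ζ h1 h2 h3) (hint 2 0 (by norm_num) le_rfl (by norm_num))]
    have hbd := norm_integral_le_of_norm_le
      (μ := volume.restrict (Set.Ioi (0 : ℝ)))
      (f := fun t : ℝ => stableKernel k a ζ y (t - Complex.I) -
        stableKernel k 2 0 y (t - Complex.I))
      (integrableOn_exp_neg_div (4 * Real.exp 10 * C * (2 - a) * Real.exp (-y)))
      ((ae_restrict_iff' measurableSet_Ioi).2 (Filter.Eventually.of_forall fun t ht => ?_))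
    · refine hbd.trans (le_of_eq ?_)
      rw [integral_const_mul, integral_exp_mul_Ioi (by norm_num)]
      simp
      ring
    · have ht0 : 0 ≤ t := (Set.mem_Ioi.1 ht).le
      have hre : (t - Complex.I : ℂ).re = t := by simp
      have him : (t - Complex.I : ℂ).im = -1 := by simp
      have s1 := strip_le_re_cpow_mul h1 h2 h3 (z := t - Complex.I) (by rw [hre]; exact ht0)
        (by rw [him]) (by rw [him]; norm_num)
      have s2 := strip_le_re_cpow_mul (a := 2) (ζ := 0) (by norm_num) le_rfl (by norm_num)
        (z := t - Complex.I) (by rw [hre]; exact ht0) (by rw [him]) (by rw [him]; norm_num)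
      rw [hre] at s1 s2
      rw [stableKernel_eq_mul, stableKernel_eq_mul, ← mul_sub, norm_mul,
        norm_neg_I_mul_pow_mul_exp, him]
      -- Both exponents have real part at most 10 − t/12, so the Lipschitz bound on that half-plane
      -- retains the decay in t.
      have e1 := norm_exp_sub_exp_le_of_re_le (M := -(t / 12 - 10))
        (a := -((t - Complex.I) ^ (a : ℂ) * (1 + ζ * Complex.I)))
        (b := -((t - Complex.I) ^ ((2 : ℝ) : ℂ) * (1 + ((0 : ℝ) : ℂ) * Complex.I)))
        (by rw [Complex.neg_re]; linarith) (by rw [Complex.neg_re]; linarith)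
      rw [neg_sub_neg, norm_sub_rev (_ * (1 + ((0 : ℝ) : ℂ) * Complex.I))] at e1
      have e2 := norm_sub_I_cpow_sub_le (a := a) (ζ := ζ) h2 h4 ht0
      have e3 : ‖(t - Complex.I : ℂ)‖ ≤ t + 2 := by
        have := norm_le_re_add_two (z := t - Complex.I) (by rw [hre]; exact ht0) (by rw [him])
          (by rw [him]; norm_num)
        rwa [hre] at this
      have e4 : Real.exp (-(t / 12 - 10)) = Real.exp 10 * Real.exp (-(1 / 12) * t) := by
        rw [← Real.exp_add]; ring_nf
      calc _ ≤ (t + 2) ^ k * Real.exp (y * -1) *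
            (Real.exp 10 * Real.exp (-(1 / 12) * t) * (4 * (2 - a) * (t + 2) ^ 3)) := by
            refine mul_le_mul (by gcongr) ?_ (norm_nonneg _) (by positivity)
            rw [← e4]
            exact e1.trans (mul_le_mul_of_nonneg_left e2 (Real.exp_pos _).le)
        _ = 4 * Real.exp 10 * (2 - a) * Real.exp (-y) *
            ((t + 2) ^ (k + 3) * Real.exp (-(1 / 12) * t)) := by
            rw [mul_neg_one]; ring
        _ ≤ 4 * Real.exp 10 * (2 - a) * Real.exp (-y) * (C * Real.exp (-(1 / 24) * t)) :=
            mul_le_mul_of_nonneg_left (h t ht0) (by positivity)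
        _ = _ := by ring
  have hre := Complex.abs_re_le_norm ((∫ t in Set.Ioi (0 : ℝ),
    stableKernel k a ζ y (t - Complex.I)) -
      ∫ t in Set.Ioi (0 : ℝ), stableKernel k 2 0 y (t - Complex.I))
  rw [Complex.sub_re] at hre
  have hfin := mul_le_mul_of_nonneg_left (hre.trans hdiff)
    (by positivity : 0 ≤ 1 / Real.pi)
  rw [← abs_of_nonneg (by positivity : 0 ≤ 1 / Real.pi), ← abs_mul, mul_sub,
    abs_of_nonneg (by positivity : 0 ≤ 1 / Real.pi)] at hfin
  refine le_trans (le_of_eq ?_) (hfin.trans (le_of_eq (by ring)))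
  congr 1
  ring

end

/-! ### Watson-type asymptotics of the vertical segment -/

/-- To be used with p = s^a. The error keeps a factor B, which will be of order Δ like the main
term; otherwise the estimate would not be uniform as Δ → 0. -/
lemma abs_exp_mul_sin_sub_le {A B p : ℝ} (hA : |A| ≤ 2) (hB0 : 0 ≤ B) (hB1 : B ≤ 1)
    (hp0 : 0 ≤ p) (hp1 : p ≤ 1) :
    |Real.exp (p * A) * Real.sin (p * B) - p * B| ≤ (2 * Real.exp 2 + 1) * B * p ^ 2 := by
  have hpA : |p * A| ≤ 2 * p := by
    rw [abs_mul, abs_of_nonneg hp0]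
    nlinarith
  have h1 : |Real.exp (p * A) - 1| ≤ Real.exp 2 * (2 * p) := by
    have hle : p * A ≤ 2 := (le_abs_self _).trans (hpA.trans (by linarith))
    have := norm_exp_sub_exp_le_of_re_le (M := 2) (a := ((p * A : ℝ) : ℂ)) (b := 0)
      (by rwa [Complex.ofReal_re]) (by simp)
    rw [Complex.exp_zero, sub_zero, Complex.norm_real, Real.norm_eq_abs, ← Complex.ofReal_exp,
      ← Complex.ofReal_one, ← Complex.ofReal_sub, Complex.norm_real, Real.norm_eq_abs] at this
    exact this.trans (mul_le_mul_of_nonneg_left hpA (Real.exp_pos _).le)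
  have hpB0 : 0 ≤ p * B := mul_nonneg hp0 hB0
  have hpB1 : p * B ≤ 1 := mul_le_one₀ hp1 hB0 hB1
  have h2 : |Real.sin (p * B)| ≤ p * B := by
    have := Real.abs_sin_le_abs (x := p * B)
    rwa [abs_of_nonneg hpB0] at this
  have h3 : |Real.sin (p * B) - p * B| ≤ (p * B) ^ 2 := by
    rcases hpB0.eq_or_lt with h | h
    · rw [← h]; simp
    · rw [abs_of_nonpos (by linarith [Real.sin_lt h])]
      have := Real.sin_gt_sub_cube h
      nlinarith [mul_nonneg (mul_nonneg hpB0 hpB0) (by linarith : 0 ≤ 1 - p * B), sq_nonneg (p * B)]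
  calc |Real.exp (p * A) * Real.sin (p * B) - p * B|
      = |(Real.exp (p * A) - 1) * Real.sin (p * B) + (Real.sin (p * B) - p * B)| := by ring_nf
    _ ≤ |Real.exp (p * A) - 1| * |Real.sin (p * B)| + |Real.sin (p * B) - p * B| := by
        rw [← abs_mul]; exact abs_add_le _ _
    _ ≤ Real.exp 2 * (2 * p) * (p * B) + (p * B) ^ 2 := by gcongr
    _ ≤ _ := by nlinarith [mul_nonneg (mul_nonneg (sq_nonneg p) hB0) (by linarith : 0 ≤ 1 - B)]

/-- Watson-type estimate for the vertical segment. -/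
lemma abs_stableVertical_sub_le (k : ℕ) {a ζ y B : ℝ} (h1 : 1 ≤ a) (h3 : |ζ| ≤ 1 / 2)
    (hB : B = Real.sin (Real.pi * a / 2) - ζ * Real.cos (Real.pi * a / 2)) (hB0 : 0 ≤ B)
    (hB1 : B ≤ 1) (hy : 0 < y) :
    |(-1) ^ k * stableVertical k a ζ y -
        B / Real.pi * Real.Gamma (k + 1 + a) * y ^ (-(k + 1 + a))|
      ≤ (2 * Real.exp 2 + 1) * B / Real.pi * Real.Gamma (k + 2 + a) * y ^ (-(k + 2 + a)) := by
  set K : ℝ := 2 * Real.exp 2 + 1 with hK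
  have hK1 : 1 ≤ K := by have := Real.exp_pos 2; linarith
  set A : ℝ := -(Real.cos (Real.pi * a / 2) + ζ * Real.sin (Real.pi * a / 2)) with hAdef
  have hA : |A| ≤ 2 := by
    rw [hAdef, abs_neg]
    refine (abs_add_le _ _).trans ?_
    rw [abs_mul]
    have e1 := Real.abs_cos_le_one (Real.pi * a / 2)
    have e2 := Real.abs_sin_le_one (Real.pi * a / 2)
    have e3 := abs_nonneg (Real.sin (Real.pi * a / 2))
    nlinarith [abs_nonneg ζ]
  have hmom : ∀ b : ℝ, 0 < b → (∫ s in Set.Ioi (0 : ℝ), s ^ (b - 1) * Real.exp (-(y * s))) =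
      Real.Gamma b * y ^ (-b) := by
    intro b hb
    rw [Real.integral_rpow_mul_exp_neg_mul_Ioi hb hy, one_div, Real.inv_rpow hy.le,
      Real.rpow_neg hy.le, mul_comm]
  have hmomi : ∀ b : ℝ, 0 < b →
      IntegrableOn (fun s : ℝ => s ^ (b - 1) * Real.exp (-(y * s))) (Set.Ioi 0) := by
    intro b hb
    have := integrableOn_rpow_mul_exp_neg_mul_rpow (s := b - 1) (p := 1) (b := y) (by linarith)
      one_pos hy
    simpa using this
  have hk0 : (0 : ℝ) ≤ k := k.cast_nonneg
  have i1 := hmomi (k + 1 + a) (by linarith)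
  have i2 := hmomi (k + 2 + a) (by linarith)
  let G : ℝ → ℝ := fun s => s ^ k * Real.exp (-(s * y)) *
    (Real.exp (s ^ a * A) * Real.sin (s ^ a * B))
  have hG : IntegrableOn G (Set.Ioc 0 1) := by
    refine (Continuous.integrableOn_Icc ?_).mono_set Set.Ioc_subset_Icc_self
    have : Continuous fun s : ℝ => s ^ a := Real.continuous_rpow_const (by linarith)
    fun_prop
  -- Extension by zero beyond s = 1 makes both terms integrals over the half-line, where the moments
  -- are exact Gamma integrals.
  have hGi : IntegrableOn ((Set.Ioc 0 1).indicator G) (Set.Ioi 0) :=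
    (hG.integrable_indicator measurableSet_Ioc).integrableOn
  have hV : (-1) ^ k * stableVertical k a ζ y =
      1 / Real.pi * ∫ s in Set.Ioi (0 : ℝ), (Set.Ioc 0 1).indicator G s := by
    rw [setIntegral_indicator measurableSet_Ioc,
      Set.inter_eq_right.2 (Set.Ioc_subset_Ioi_self : Set.Ioc (0 : ℝ) 1 ⊆ Set.Ioi 0), stableVertical,
      mul_left_comm, ← integral_const_mul]
    congr 1
    refine setIntegral_congr_fun measurableSet_Ioc fun s _ => ?_
    simp only [G, hB]
    rw [← mul_assoc, ← mul_assoc ((-1 : ℝ) ^ k), ← mul_pow, neg_one_mul, neg_neg]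
  have hmain : B / Real.pi * Real.Gamma (k + 1 + a) * y ^ (-(k + 1 + a)) =
      1 / Real.pi * ∫ s in Set.Ioi (0 : ℝ), B * (s ^ ((k + 1 + a) - 1) * Real.exp (-(y * s))) := by
    rw [integral_const_mul, hmom _ (by linarith)]
    ring
  rw [hV, hmain, ← mul_sub, ← integral_sub hGi (i1.const_mul B), abs_mul,
    abs_of_pos (by positivity : 0 < 1 / Real.pi)]
  have hbd := norm_integral_le_of_norm_le
    (μ := volume.restrict (Set.Ioi (0 : ℝ)))
    (f := fun s => (Set.Ioc 0 1).indicator G s -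
      B * (s ^ ((k + 1 + a) - 1) * Real.exp (-(y * s))))
    (i2.const_mul (K * B))
    ((ae_restrict_iff' measurableSet_Ioi).2 (Filter.Eventually.of_forall fun s hs => ?_))
  · rw [integral_const_mul, hmom _ (by linarith), Real.norm_eq_abs] at hbd
    calc _ ≤ 1 / Real.pi * (K * B * (Real.Gamma (k + 2 + a) * y ^ (-(k + 2 + a)))) :=
          mul_le_mul_of_nonneg_left hbd (by positivity)
      _ = _ := by ring
  · have hs : 0 < s := hs
    have p1 : s ^ ((k + 1 + a) - 1) = s ^ k * s ^ a := by
      rw [← Real.rpow_natCast, ← Real.rpow_add hs]; ring_nf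
    have p2 : s ^ ((k + 2 + a) - 1) = s ^ k * (s ^ a * s) := by
      rw [← Real.rpow_natCast, ← Real.rpow_add_one hs.ne', ← Real.rpow_add hs]; ring_nf
    have hsa : 0 < s ^ a := Real.rpow_pos_of_pos hs a
    rw [p1, p2, Real.norm_eq_abs]
    by_cases hs1 : s ≤ 1
    · have hsa1 : s ^ a ≤ 1 := Real.rpow_le_one hs.le hs1 (by linarith)
      -- As a ≥ 1, the error p² = s^a · s^a is at most s^a · s: one extra power of s, hence of 1/y.
      have hsas : s ^ a ≤ s := by
        simpa using Real.rpow_le_rpow_of_exponent_ge hs hs1 h1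
      have e := abs_exp_mul_sin_sub_le hA hB0 hB1 hsa.le hsa1
      rw [Set.indicator_of_mem (show s ∈ Set.Ioc (0 : ℝ) 1 from ⟨hs, hs1⟩)]
      simp only [G]
      have e2 : s ^ k * Real.exp (-(s * y)) * (Real.exp (s ^ a * A) * Real.sin (s ^ a * B)) -
          B * (s ^ k * s ^ a * Real.exp (-(y * s))) = s ^ k * Real.exp (-(y * s)) *
            (Real.exp (s ^ a * A) * Real.sin (s ^ a * B) - s ^ a * B) := by
        rw [mul_comm s y]; ring
      rw [e2, abs_mul, abs_of_nonneg (by positivity)]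
      calc _ ≤ s ^ k * Real.exp (-(y * s)) * (K * B * (s ^ a * s)) := by
            refine mul_le_mul_of_nonneg_left (e.trans ?_) (by positivity)
            rw [pow_two]
            gcongr
        _ = _ := by ring
    -- For s > 1 the discrepancy is the whole main term, absorbed because K ≥ 1 and s ≥ 1.
    · rw [Set.indicator_of_notMem (fun h => hs1 h.2), zero_sub, abs_neg,
        abs_of_nonneg (by positivity)]
      push Not at hs1
      calc B * (s ^ k * s ^ a * Real.exp (-(y * s)))
          = 1 * B * (s ^ k * (s ^ a * 1) * Real.exp (-(y * s))) := by ring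
        _ ≤ K * B * (s ^ k * (s ^ a * s) * Real.exp (-(y * s))) := by gcongr

/-! ### Expansions as Δ → 0 and the uniform tail estimate -/

lemma stableShift_two_sub (Δ β : ℝ) :
    stableShift (2 - Δ) β = β * Real.tan (Real.pi * Δ / 2) := by
  rw [stableShift, show Real.pi * (2 - Δ) / 2 = Real.pi - Real.pi * Δ / 2 by ring,
    Real.tan_pi_sub]
  ring

-- The constant 2 works because tan(πΔ/2) has slope π/2 < 2 at 0.
open Filter Topology in
lemma eventually_abs_stableShift_le {β : ℝ} (hβ : |β| ≤ 1) :
    ∀ᶠ Δ : ℝ in 𝓝 0, |stableShift (2 - Δ) β| ≤ 2 * |Δ| := by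
  have h1 : HasDerivAt (fun Δ : ℝ => Real.pi * Δ / 2) (Real.pi / 2) 0 := by
    simpa using ((hasDerivAt_id (0 : ℝ)).const_mul Real.pi).div_const 2
  have h2 : HasDerivAt (fun Δ : ℝ => Real.tan (Real.pi * Δ / 2)) (Real.pi / 2) 0 := by
    have := (Real.hasDerivAt_tan (x := Real.pi * 0 / 2) (by simp)).comp (0 : ℝ) h1
    refine this.congr_deriv ?_
    simp
  have h3 := (hasDerivAt_iff_isLittleO.1 h2).def
    (show (0 : ℝ) < 2 - Real.pi / 2 by linarith [Real.pi_lt_four])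
  filter_upwards [h3] with Δ hΔ
  simp only [mul_zero, zero_div, Real.tan_zero, sub_zero, smul_eq_mul, Real.norm_eq_abs] at hΔ
  rw [stableShift_two_sub, abs_mul]
  have e1 := abs_sub_abs_le_abs_sub (Real.tan (Real.pi * Δ / 2)) (Δ * (Real.pi / 2))
  rw [abs_mul, abs_of_pos (by positivity : 0 < Real.pi / 2)] at e1
  have e2 : |Real.tan (Real.pi * Δ / 2)| ≤ 2 * |Δ| := by linarith
  exact (mul_le_of_le_one_left (abs_nonneg _) hβ).trans e2

-- First-order expansion at 0: the sine vanishes there, so only the value Γ(k+3) and the slope 1/2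
-- of sin(πΔ/2)/π enter.
open Filter Topology in
lemma eventually_abs_sin_mul_Gamma_sub_le (k : ℕ) {ε : ℝ} (hε : 0 < ε) :
    ∀ᶠ Δ : ℝ in 𝓝 0, |Real.sin (Real.pi * Δ / 2) / Real.pi * Real.Gamma (k + 3 - Δ) -
      Δ * (Real.Gamma (k + 3) / 2)| ≤ ε * |Δ| := by
  have h1 : HasDerivAt (fun Δ : ℝ => Real.pi * Δ / 2) (Real.pi / 2) 0 := by
    simpa using ((hasDerivAt_id (0 : ℝ)).const_mul Real.pi).div_const 2
  have hG : DifferentiableAt ℝ (fun Δ : ℝ => Real.Gamma (k + 3 - Δ)) 0 := by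
    have h0 : DifferentiableAt ℝ Real.Gamma (k + 3 - 0) := by
      refine Real.differentiableAt_Gamma fun m h => ?_
      have : (0 : ℝ) ≤ k := k.cast_nonneg
      have : (0 : ℝ) ≤ m := m.cast_nonneg
      linarith
    exact h0.comp (0 : ℝ) (f := fun Δ : ℝ => (k + 3 - Δ : ℝ)) (by fun_prop)
  have h2 := (h1.sin.div_const Real.pi).mul hG.hasDerivAt
  have h3 := (hasDerivAt_iff_isLittleO.1 h2).def hε
  filter_upwards [h3] with Δ hΔ
  have hpi := Real.pi_ne_zero
  simp only [Pi.mul_apply, mul_zero, zero_div, Real.sin_zero, sub_zero, smul_eq_mul,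
    Real.norm_eq_abs, zero_mul, add_zero, Real.cos_zero, one_mul] at hΔ
  convert hΔ using 3
  field_simp

open Filter Topology in
/-- Uniform asymptotics of the density of a centred stable law and of its derivatives as the
exponent tends to `2` and the argument to `∞`. -/
lemma exists_abs_stableHalfLine_sub_tail_le (k : ℕ) {β : ℝ} (hβ₁ : -1 < β) (hβ₂ : β < 1) {ε : ℝ}
    (hε : 0 < ε) : ∃ y₀ : ℝ, 1 ≤ y₀ ∧ ∀ᶠ Δ : ℝ in 𝓝[>] 0, ∀ y : ℝ, y₀ < y →
      |stableHalfLine k (2 - Δ) (stableShift (2 - Δ) β) y - stableHalfLine k 2 0 y -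
        (-1) ^ k * (1 + β) * Δ * (Real.Gamma (k + 3) / 2) * y ^ (Δ - 3 - k)|
          ≤ ε * (Δ * y ^ (Δ - 3 - k)) := by
  obtain ⟨C, hC, hmain⟩ := exists_abs_stableHalfLine_sub_le k
  have hβ : |β| ≤ 1 := abs_le.2 ⟨hβ₁.le, hβ₂.le⟩
  have hk0 : (0 : ℝ) ≤ k := k.cast_nonneg
  set K : ℝ := 2 * Real.exp 2 + 1 with hK
  have hK0 : 0 < K := by positivity
  set M : ℝ := Real.Gamma (k + 4) + 1 with hM
  have hM0 : 0 < M := by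
    have := Real.Gamma_pos_of_pos (by linarith : (0 : ℝ) < k + 4)
    linarith
  have hGc : ∀ᶠ Δ : ℝ in 𝓝 0, Real.Gamma (k + 4 - Δ) < M := by
    have hc : ContinuousAt (fun Δ : ℝ => Real.Gamma (k + 4 - Δ)) 0 := by
      have h0 : ContinuousAt Real.Gamma (k + 4 - 0) := by
        refine (Real.differentiableAt_Gamma fun m h => ?_).continuousAt
        have : (0 : ℝ) ≤ m := m.cast_nonneg
        linarith
      exact h0.comp (f := fun Δ : ℝ => (k + 4 - Δ : ℝ)) (x := (0 : ℝ)) (by fun_prop)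
    exact hc.eventually_lt_const (by simp [hM])
  -- Each of three errors gets ε/3. Large y handles the Watson remainder KM/y and the shifted line
  -- C(k+4)!/y; small Δ handles the coefficient, where ε/6 allows for 1 + β ≤ 2.
  refine ⟨max 1 (max (3 * (K * M) / ε) (3 * (C * (k + 4).factorial) / ε)), le_max_left _ _, ?_⟩
  have hsmall : ∀ᶠ Δ : ℝ in 𝓝 (0 : ℝ), Δ < 1 / 4 := eventually_lt_nhds (by norm_num)
  filter_upwards [hGc.filter_mono nhdsWithin_le_nhds, hsmall.filter_mono nhdsWithin_le_nhds,
    (eventually_abs_stableShift_le hβ).filter_mono nhdsWithin_le_nhds,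
    (eventually_abs_sin_mul_Gamma_sub_le k (by positivity : 0 < ε / 6)).filter_mono
      nhdsWithin_le_nhds, self_mem_nhdsWithin] with Δ hΔG hΔ4 hζ hsin hΔ0 y hy
  have hΔ0 : 0 < Δ := hΔ0
  rw [abs_of_pos hΔ0] at hζ hsin
  have hy1 : 1 < y := (le_max_left _ _).trans_lt hy
  have hyKM : 3 * (K * M) / ε < y :=
    ((le_max_left _ _).trans (le_max_right _ _)).trans_lt hy
  have hyC : 3 * (C * (k + 4).factorial) / ε < y :=
    ((le_max_right _ _).trans (le_max_right _ _)).trans_lt hy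
  rw [div_lt_iff₀ hε] at hyKM hyC
  have hy0 : 0 < y := by linarith
  set ζ := stableShift (2 - Δ) β with hζdef
  have hpi0 := Real.pi_pos
  have hpi4 := Real.pi_lt_four
  have hang0 : 0 < Real.pi * Δ / 2 := by positivity
  have hang1 : Real.pi * Δ / 2 < Real.pi / 2 := by nlinarith
  have hcos : 0 < Real.cos (Real.pi * Δ / 2) :=
    Real.cos_pos_of_mem_Ioo ⟨by linarith, hang1⟩
  have hsin0 : 0 < Real.sin (Real.pi * Δ / 2) :=
    Real.sin_pos_of_pos_of_lt_pi hang0 (by linarith)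
  have hsin1 : Real.sin (Real.pi * Δ / 2) < Real.pi * Δ / 2 := Real.sin_lt hang0
  set B : ℝ := (1 + β) * Real.sin (Real.pi * Δ / 2) with hBdef
  -- With θ = πΔ/2 the right side is sin θ + ζ cos θ, and ζ = β tan θ.
  have hB : B = Real.sin (Real.pi * (2 - Δ) / 2) - ζ * Real.cos (Real.pi * (2 - Δ) / 2) := by
    rw [hζdef, stableShift_two_sub, show Real.pi * (2 - Δ) / 2 = Real.pi - Real.pi * Δ / 2 by ring,
      Real.sin_pi_sub, Real.cos_pi_sub, Real.tan_eq_sin_div_cos, hBdef]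
    field_simp
    ring
  have hB0 : 0 ≤ B := by
    have : 0 ≤ 1 + β := by linarith
    positivity
  have hBle : B ≤ Real.pi * Δ := by nlinarith
  have hB1 : B ≤ 1 := by nlinarith
  have b1 := hmain (2 - Δ) ζ y (by linarith) (by linarith) (by linarith) (by linarith) hy0.le
  rw [sub_sub_cancel] at b1
  have b2 := abs_stableVertical_sub_le k (a := 2 - Δ) (ζ := ζ) (by linarith) (by linarith) hB hB0
    hB1 hy0
  rw [show -(k + 1 + (2 - Δ) : ℝ) = Δ - 3 - k by ring,
    show (k + 1 + (2 - Δ) : ℝ) = k + 3 - Δ by ring,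
    show -(k + 2 + (2 - Δ) : ℝ) = (Δ - 3 - k) - 1 by ring,
    show (k + 2 + (2 - Δ) : ℝ) = k + 4 - Δ by ring, Real.rpow_sub_one hy0.ne'] at b2
  set Y : ℝ := y ^ (Δ - 3 - k) with hY
  have hY0 : 0 < Y := Real.rpow_pos_of_pos hy0 _
  have b2' : K * B / Real.pi * Real.Gamma (k + 4 - Δ) * (Y / y) ≤ ε / 3 * (Δ * Y) := by
    have e1 : K * B / Real.pi * Real.Gamma (k + 4 - Δ) ≤ K * Δ * M := by
      refine mul_le_mul ?_ hΔG.le (Real.Gamma_pos_of_pos (by linarith)).le (by positivity)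
      rw [div_le_iff₀ hpi0]
      nlinarith
    calc _ ≤ K * Δ * M * (Y / y) := mul_le_mul_of_nonneg_right e1 (by positivity)
      _ = (K * M) / y * (Δ * Y) := by field_simp
      _ ≤ _ := by
        refine mul_le_mul_of_nonneg_right ?_ (by positivity)
        rw [div_le_iff₀ hy0]
        linarith
  have b1' : C * Δ * Real.exp (-y) ≤ ε / 3 * (Δ * Y) := by
    have e1 := Real.pow_div_factorial_le_exp y hy0.le (k + 4)
    have e2 : Real.exp (-y) ≤ (k + 4).factorial / y ^ (k + 4) := by
      rw [Real.exp_neg, ← inv_div]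
      exact inv_anti₀ (by positivity) e1
    have e3 : 1 / y ^ (k + 3) ≤ Y := by
      rw [one_div, ← Real.rpow_natCast, ← Real.rpow_neg hy0.le]
      refine Real.rpow_le_rpow_of_exponent_le hy1.le ?_
      push_cast
      linarith
    calc C * Δ * Real.exp (-y) ≤ C * Δ * ((k + 4).factorial / y ^ (k + 4)) := by gcongr
      _ = (C * (k + 4).factorial / y) * (Δ * (1 / y ^ (k + 3))) := by
        field_simp
        ring
      _ ≤ ε / 3 * (Δ * Y) := by
        refine mul_le_mul ?_ (by gcongr) (by positivity) (by positivity)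
        rw [div_le_iff₀ hy0]
        linarith
  have b3 : |B / Real.pi * Real.Gamma (k + 3 - Δ) * Y -
      (1 + β) * Δ * (Real.Gamma (k + 3) / 2) * Y| ≤ ε / 3 * (Δ * Y) := by
    have : B / Real.pi * Real.Gamma (k + 3 - Δ) * Y - (1 + β) * Δ * (Real.Gamma (k + 3) / 2) * Y =
        (1 + β) * Y * (Real.sin (Real.pi * Δ / 2) / Real.pi * Real.Gamma (k + 3 - Δ) -
          Δ * (Real.Gamma (k + 3) / 2)) := by
      rw [hBdef]; ring
    rw [this, abs_mul, abs_of_nonneg (mul_nonneg (by linarith) hY0.le)]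
    calc (1 + β) * Y * _ ≤ 2 * Y * (ε / 6 * Δ) := by
          refine mul_le_mul ?_ hsin (abs_nonneg _) (by positivity)
          exact mul_le_mul_of_nonneg_right (by linarith) hY0.le
      _ = _ := by ring
  have hsq : ((-1 : ℝ) ^ k) * (-1) ^ k = 1 := by rw [← mul_pow]; simp
  have habs : |(-1 : ℝ) ^ k| = 1 := by simp
  have hV : |stableVertical k (2 - Δ) ζ y - (-1) ^ k * (1 + β) * Δ * (Real.Gamma (k + 3) / 2) * Y|
      = |(-1) ^ k * stableVertical k (2 - Δ) ζ y - (1 + β) * Δ * (Real.Gamma (k + 3) / 2) * Y| := by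
    have e : (-1) ^ k * stableVertical k (2 - Δ) ζ y -
        (1 + β) * Δ * (Real.Gamma (k + 3) / 2) * Y = (-1) ^ k * (stableVertical k (2 - Δ) ζ y -
          (-1) ^ k * (1 + β) * Δ * (Real.Gamma (k + 3) / 2) * Y) := by
      linear_combination ((1 + β) * Δ * (Real.Gamma (k + 3) / 2) * Y) * hsq
    rw [e, abs_mul, habs, one_mul]
  have t1 := abs_sub_le (stableHalfLine k (2 - Δ) ζ y - stableHalfLine k 2 0 y)
    (stableVertical k (2 - Δ) ζ y) ((-1) ^ k * (1 + β) * Δ * (Real.Gamma (k + 3) / 2) * Y)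
  have t2 := abs_sub_le ((-1) ^ k * stableVertical k (2 - Δ) ζ y)
    (B / Real.pi * Real.Gamma (k + 3 - Δ) * Y) ((1 + β) * Δ * (Real.Gamma (k + 3) / 2) * Y)
  rw [hV] at t1
  linarith

-- For y < 0, `stableHalfLine_neg` passes to −y and −ζ. Since ζ is odd in β, this is the one-sided
-- estimate for −β.
open Filter Topology in
lemma exists_abs_stableHalfLine_sub_two_sided_tail_le (k : ℕ) {β : ℝ} (hβ₁ : -1 < β) (hβ₂ : β < 1)
    {ε : ℝ} (hε : 0 < ε) : ∃ y₀ : ℝ, 1 ≤ y₀ ∧ ∀ᶠ Δ : ℝ in 𝓝[>] 0, ∀ y : ℝ, y₀ < |y| →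
      |stableHalfLine k (2 - Δ) (stableShift (2 - Δ) β) y - stableHalfLine k 2 0 y -
        (-Real.sign y) ^ k * (1 + β * Real.sign y) * Δ * (Real.Gamma (k + 3) / 2) *
          |y| ^ (Δ - 3 - k)| ≤ ε * (Δ * |y| ^ (Δ - 3 - k)) := by
  obtain ⟨y₁, hy₁, h₁⟩ := exists_abs_stableHalfLine_sub_tail_le k hβ₁ hβ₂ hε
  obtain ⟨y₂, hy₂, h₂⟩ := exists_abs_stableHalfLine_sub_tail_le k (β := -β) (by linarith)
    (by linarith) hε
  refine ⟨max y₁ y₂, hy₁.trans (le_max_left _ _), ?_⟩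
  filter_upwards [h₁, h₂] with Δ g₁ g₂ y hy
  rcases le_total 0 y with h0 | h0
  · rw [abs_of_nonneg h0] at hy ⊢
    have hy0 : 0 < y := by linarith [le_max_left y₁ y₂]
    rw [Real.sign_of_pos hy0, mul_one]
    exact g₁ y ((le_max_left _ _).trans_lt hy)
  · rw [abs_of_nonpos h0] at hy ⊢
    have hy0 : y < 0 := by linarith [le_max_left y₁ y₂]
    have hs : stableShift (2 - Δ) (-β) = -stableShift (2 - Δ) β := by simp [stableShift]
    have g := g₂ (-y) ((le_max_right _ _).trans_lt hy)
    rw [Real.sign_of_neg hy0, neg_neg, one_pow, one_mul, mul_neg_one]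
    have e1 := stableHalfLine_neg k (2 - Δ) (stableShift (2 - Δ) β) (-y)
    have e2 := stableHalfLine_neg k 2 0 (-y)
    rw [neg_neg] at e1 e2
    rw [neg_zero] at e2
    rw [hs] at g
    rw [e1, e2]
    have hsq : ((-1 : ℝ) ^ k) * (-1) ^ k = 1 := by rw [← mul_pow]; simp
    refine le_trans (le_of_eq ?_) g
    rw [← one_mul |stableHalfLine k (2 - Δ) (-stableShift (2 - Δ) β) (-y) - _ - _|,
      show (1 : ℝ) = |(-1 : ℝ) ^ k| by simp, ← abs_mul]
    congr 1
    simp only [abs_pow, abs_neg, abs_one, one_pow]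
    linear_combination ((1 + -β) * Δ * (Real.Gamma (k + 3) / 2) * (-y) ^ (Δ - 3 - k)) * hsq

/-! ### The approximations g and g_μ, and relative error bounds -/

lemma normalDensityTwo_pos (y : ℝ) : 0 < normalDensityTwo y := by
  have := Real.pi_pos
  rw [normalDensityTwo]
  positivity

lemma one_sub_abs_le_one_add_mul_sign (β y : ℝ) : 1 - |β| ≤ 1 + β * Real.sign y := by
  rcases Real.sign_apply_eq y with h | h | h <;> rw [h]
  · linarith [le_abs_self β]
  · linarith [abs_nonneg β]
  · linarith [neg_abs_le β]

lemma one_add_mul_sign_le_two {β : ℝ} (hβ : |β| < 1) (y : ℝ) : 1 + β * Real.sign y ≤ 2 := by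
  rcases Real.sign_apply_eq y with h | h | h <;> rw [h]
  · linarith [neg_abs_le β]
  · linarith
  · linarith [le_abs_self β]

lemma sign_mul_abs_rpow_sub_one {y : ℝ} (hy : y ≠ 0) (p : ℝ) :
    Real.sign y * |y| ^ (p - 1) = |y| ^ p / y := by
  rw [Real.rpow_sub_one (abs_ne_zero.2 hy)]
  rcases lt_or_gt_of_ne hy with h | h
  · rw [Real.sign_of_neg h, abs_of_neg h]
    field_simp
  · rw [Real.sign_of_pos h, abs_of_pos h]
    field_simp

/-- Turns errors measured in Δ|y|^(Δ−3) into errors relative to the tail term, as long as |β| stays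
below 1. -/
lemma le_tailPart {Δ β x : ℝ} (hΔ : 0 < Δ) :
    (1 - |β|) * (Δ * |x - stableShift (2 - Δ) β| ^ (Δ - 3)) ≤ tailPart (2 - Δ) β x := by
  rw [tailPart, sub_sub_cancel, mul_assoc]
  exact mul_le_mul_of_nonneg_right (one_sub_abs_le_one_add_mul_sign _ _) (by positivity)

lemma tailPart_le {Δ β x : ℝ} (hβ : |β| < 1) (hΔ : 0 < Δ) :
    tailPart (2 - Δ) β x ≤ 2 * (Δ * |x - stableShift (2 - Δ) β| ^ (Δ - 3)) := by
  rw [tailPart, sub_sub_cancel, mul_assoc]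
  exact mul_le_mul_of_nonneg_right (one_add_mul_sign_le_two hβ _) (by positivity)

lemma tailPart_pos {Δ β x : ℝ} (hβ : |β| < 1) (hΔ : 0 < Δ) (hx : x - stableShift (2 - Δ) β ≠ 0) :
    0 < tailPart (2 - Δ) β x := by
  refine lt_of_lt_of_le ?_ (le_tailPart hΔ)
  have : 0 < |x - stableShift (2 - Δ) β| := abs_pos.2 hx
  have : 0 < 1 - |β| := by linarith
  positivity

/-- With the factor 3 in place of 3 − Δ the ratio of the tail terms is exactly −3/y, so g_μ/g is an
exact weighted mean of y/2 and 3/y. -/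
lemma tailPart'_eq {Δ β x : ℝ} (hx : x - stableShift (2 - Δ) β ≠ 0) :
    tailPart' (2 - Δ) β x = -(3 / (x - stableShift (2 - Δ) β) * tailPart (2 - Δ) β x) := by
  rw [tailPart', tailPart, sub_sub_cancel, show Δ - 4 = (Δ - 3) - 1 by ring,
    sign_mul_abs_rpow_sub_one hx]
  ring

lemma approxMu_eq {Δ β x : ℝ} (hx : x - stableShift (2 - Δ) β ≠ 0) :
    approxMu (2 - Δ) β x = (x - stableShift (2 - Δ) β) / 2 * gaussPart (2 - Δ) β x +
      3 / (x - stableShift (2 - Δ) β) * tailPart (2 - Δ) β x := by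
  rw [approxMu, approxDensity', tailPart'_eq hx, gaussPart', gaussPart]
  ring

/-- Both summands of g_μ have the sign of y, so they never cancel and each bounds |g_μ| from below.
-/
lemma abs_approxMu_eq {Δ β x : ℝ} (hβ : |β| < 1) (hΔ : 0 < Δ)
    (hx : x - stableShift (2 - Δ) β ≠ 0) :
    |approxMu (2 - Δ) β x| = |x - stableShift (2 - Δ) β| / 2 * gaussPart (2 - Δ) β x +
      3 / |x - stableShift (2 - Δ) β| * tailPart (2 - Δ) β x := by
  have hT := tailPart_pos hβ hΔ hx
  have hφ : 0 < gaussPart (2 - Δ) β x := normalDensityTwo_pos _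
  rw [approxMu_eq hx]
  set y := x - stableShift (2 - Δ) β
  rcases lt_or_gt_of_ne hx with h | h
  · have e : y / 2 * gaussPart (2 - Δ) β x + 3 / y * tailPart (2 - Δ) β x =
        -(-y / 2 * gaussPart (2 - Δ) β x + 3 / -y * tailPart (2 - Δ) β x) := by
      rw [div_neg]; ring
    have h' : 0 < -y := by linarith
    rw [e, abs_neg, abs_of_neg h, abs_of_pos (by positivity)]
  · rw [abs_of_pos h, abs_of_pos (by positivity)]

lemma approxDensity_pos {Δ β x : ℝ} (hβ : |β| < 1) (hΔ : 0 < Δ)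
    (hx : x - stableShift (2 - Δ) β ≠ 0) : 0 < approxDensity (2 - Δ) β x :=
  add_pos (normalDensityTwo_pos _) (tailPart_pos hβ hΔ hx)

-- The error is small against the tail term, while g is at least that term T and |g_μ| at least
-- 3T/|y|.
open Filter Topology in
lemma exists_abs_stableDensity_sub_approxDensity_le {β : ℝ} (hβ₁ : -1 < β) (hβ₂ : β < 1) {ε : ℝ}
    (hε : 0 < ε) : ∃ y₀ : ℝ, 1 ≤ y₀ ∧ ∀ᶠ Δ : ℝ in 𝓝[>] 0, ∀ x : ℝ,
      y₀ < |x - stableShift (2 - Δ) β| →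
      |stableDensity 0 1 (2 - Δ) β x - approxDensity (2 - Δ) β x|
          ≤ ε * approxDensity (2 - Δ) β x ∧
        |stableDensityMu (2 - Δ) β x - approxMu (2 - Δ) β x| ≤ ε * |approxMu (2 - Δ) β x| := by
  have hβ : |β| < 1 := abs_lt.2 ⟨hβ₁, hβ₂⟩
  have hb : 0 < 1 - |β| := by linarith
  have hε' : 0 < ε * (1 - |β|) := by positivity
  obtain ⟨y₁, hy₁, h₁⟩ := exists_abs_stableHalfLine_sub_two_sided_tail_le 0 hβ₁ hβ₂ hε'
  obtain ⟨y₂, hy₂, h₂⟩ := exists_abs_stableHalfLine_sub_two_sided_tail_le 1 hβ₁ hβ₂ hε'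
  refine ⟨max y₁ y₂, hy₁.trans (le_max_left _ _), ?_⟩
  filter_upwards [h₁, h₂, (eventually_abs_stableShift_le hβ.le).filter_mono nhdsWithin_le_nhds,
    (eventually_lt_nhds (by norm_num : (0 : ℝ) < 1 / 4)).filter_mono nhdsWithin_le_nhds,
    self_mem_nhdsWithin] with Δ g₁ g₂ hζ hΔ4 hΔ0 x hx
  have hΔ0 : 0 < Δ := hΔ0
  rw [abs_of_pos hΔ0] at hζ
  have hy0 : 0 < |x - stableShift (2 - Δ) β| := by linarith [le_max_left y₁ y₂]
  have hyne := abs_pos.1 hy0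
  have g₁ := g₁ _ ((le_max_left _ _).trans_lt hx)
  have g₂ := g₂ _ ((le_max_right _ _).trans_lt hx)
  -- Γ(3)/2 = 1 and Γ(4)/2 = 3 are the coefficients in `tailPart` and `tailPart'`.
  have G1 : Real.Gamma ((0 : ℕ) + 3) / 2 = 1 := by
    rw [show (((0 : ℕ) : ℝ) + 3) = ((2 : ℕ) : ℝ) + 1 by norm_num, Real.Gamma_nat_eq_factorial]
    norm_num [Nat.factorial]
  have G2 : Real.Gamma ((1 : ℕ) + 3) / 2 = 3 := by
    rw [show (((1 : ℕ) : ℝ) + 3) = ((3 : ℕ) : ℝ) + 1 by norm_num, Real.Gamma_nat_eq_factorial]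
    norm_num [Nat.factorial]
  rw [G1, stableHalfLine_two_zero_eq] at g₁
  rw [G2, stableHalfLine_one_two_zero_eq] at g₂
  have hT := le_tailPart (β := β) (x := x) hΔ0
  have hTpos := tailPart_pos hβ hΔ0 hyne
  have hφ : 0 < gaussPart (2 - Δ) β x := normalDensityTwo_pos _
  constructor
  · rw [stableDensity_eq_stableHalfLine 0 x (by linarith) (by linarith) (by linarith), sub_zero]
    have e1 : ε * ((1 - |β|) * (Δ * |x - stableShift (2 - Δ) β| ^ (Δ - 3))) ≤
        ε * approxDensity (2 - Δ) β x := by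
      refine mul_le_mul_of_nonneg_left (hT.trans ?_) hε.le
      rw [approxDensity]; linarith
    refine le_trans (le_of_eq ?_) (g₁.trans (le_trans (le_of_eq ?_) e1))
    · congr 1
      rw [approxDensity, gaussPart, tailPart, sub_sub_cancel]
      push_cast
      rw [sub_zero]
      ring
    · push_cast
      rw [sub_zero]
      ring
  · rw [stableDensityMu_eq_stableHalfLine x (by linarith) (by linarith) (by linarith)]
    have e2 : Δ * |x - stableShift (2 - Δ) β| ^ (Δ - 4) =
        1 / |x - stableShift (2 - Δ) β| * (Δ * |x - stableShift (2 - Δ) β| ^ (Δ - 3)) := by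
      rw [show Δ - 4 = (Δ - 3) - 1 by ring, Real.rpow_sub_one hy0.ne']
      ring
    have e1 : ε * ((1 - |β|) * (Δ * |x - stableShift (2 - Δ) β| ^ (Δ - 4))) ≤
        ε * |approxMu (2 - Δ) β x| := by
      refine mul_le_mul_of_nonneg_left ?_ hε.le
      rw [abs_approxMu_eq hβ hΔ0 hyne, e2]
      calc _ = 1 / |x - stableShift (2 - Δ) β| *
            ((1 - |β|) * (Δ * |x - stableShift (2 - Δ) β| ^ (Δ - 3))) := by ring
        _ ≤ 3 / |x - stableShift (2 - Δ) β| * tailPart (2 - Δ) β x := by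
          refine mul_le_mul ?_ hT (by positivity) (by positivity)
          gcongr
          norm_num
        _ ≤ _ := le_add_of_nonneg_left (by positivity)
    refine le_trans (le_of_eq ?_) (g₂.trans (le_trans (le_of_eq ?_) e1))
    · rw [← abs_neg]
      congr 1
      rw [approxMu, approxDensity', gaussPart', tailPart', sub_sub_cancel]
      push_cast
      rw [show Δ - 3 - 1 = Δ - 4 by ring]
      ring
    · push_cast
      rw [show Δ - 3 - 1 = Δ - 4 by ring]
      ring

/-! ### The ratio g_μ/g in the Gaussian, tail and transition ranges -/

open Filter Topology in
lemma exists_forall_of_eventually_nhdsGT_zero {P : ℝ → Prop} (h : ∀ᶠ Δ in 𝓝[>] (0 : ℝ), P Δ) :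
    ∃ Δ₀ : ℝ, 0 < Δ₀ ∧ ∀ Δ, 0 < Δ → Δ < Δ₀ → P Δ := by
  obtain ⟨u, hu, hs⟩ := mem_nhdsGT_iff_exists_Ioo_subset.1 h
  exact ⟨u, hu, fun Δ h0 h1 => hs ⟨h0, h1⟩⟩

open Filter Topology in
lemma eventually_nhdsGT_mul_rpow_le {κ C η : ℝ} (hκ : 0 < κ) (hη : 0 < η) :
    ∀ᶠ Δ in 𝓝[>] (0 : ℝ), C * Δ ^ κ ≤ η := by
  have h : Tendsto (fun Δ : ℝ => C * Δ ^ κ) (𝓝 0) (𝓝 (C * 0 ^ κ)) :=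
    ((Real.continuous_rpow_const hκ.le).tendsto 0).const_mul C
  rw [Real.zero_rpow hκ.ne', mul_zero] at h
  exact (h.eventually_le_const hη).filter_mono nhdsWithin_le_nhds

open Filter Topology in
lemma eventually_nhdsGT_le_mul_sqrt_log (M : ℝ) {b : ℝ} (hb : 0 < b) :
    ∀ᶠ Δ in 𝓝[>] (0 : ℝ), M ≤ b * Real.sqrt (Real.log (1 / Δ)) := by
  have h1 : Tendsto (fun Δ : ℝ => Real.log (1 / Δ)) (𝓝[>] 0) atTop := by
    simp only [one_div, Real.log_inv]
    exact tendsto_neg_atBot_atTop.comp Real.tendsto_log_nhdsGT_zero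
  exact ((Real.tendsto_sqrt_atTop.comp h1).const_mul_atTop hb).eventually_ge_atTop M

lemma exp_neg_mul_log_one_div {Δ : ℝ} (hΔ : 0 < Δ) (p : ℝ) :
    Real.exp (-(p * Real.log (1 / Δ))) = Δ ^ p := by
  rw [Real.rpow_def_of_pos hΔ, one_div, Real.log_inv]
  ring_nf

/-- With T the tail term, g_μ − g·y/2 = (y/2)·T·(6/y² − 1): only the weight of the tail has to be
small. -/
lemma abs_div_sub_div_two_le {Δ β x e : ℝ} (hβ : |β| < 1) (hΔ : 0 < Δ)
    (hx : x - stableShift (2 - Δ) β ≠ 0) (he : 0 ≤ e)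
    (h : tailPart (2 - Δ) β x * (6 / |x - stableShift (2 - Δ) β| ^ 2 + 1) ≤
      e * gaussPart (2 - Δ) β x) :
    |approxMu (2 - Δ) β x / approxDensity (2 - Δ) β x - (x - stableShift (2 - Δ) β) / 2| ≤
      e * |(x - stableShift (2 - Δ) β) / 2| := by
  have hg := approxDensity_pos hβ hΔ hx
  have hT := tailPart_pos hβ hΔ hx
  rw [div_sub' hg.ne', abs_div, abs_of_pos hg, div_le_iff₀ hg, approxMu_eq hx]
  have hgT : gaussPart (2 - Δ) β x ≤ approxDensity (2 - Δ) β x := by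
    rw [approxDensity]; linarith
  rw [sq_abs] at h
  set y := x - stableShift (2 - Δ) β
  have e1 : y / 2 * gaussPart (2 - Δ) β x + 3 / y * tailPart (2 - Δ) β x -
      approxDensity (2 - Δ) β x * (y / 2) = y / 2 * (tailPart (2 - Δ) β x * (6 / y ^ 2 - 1)) := by
    rw [approxDensity]; field_simp; ring
  have e2 : |6 / y ^ 2 - 1| ≤ 6 / y ^ 2 + 1 := by
    have : 0 ≤ 6 / y ^ 2 := by positivity
    exact abs_le.2 ⟨by linarith, by linarith⟩
  rw [e1, abs_mul, abs_mul, abs_of_pos hT, mul_comm e, mul_assoc]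
  exact mul_le_mul_of_nonneg_left ((mul_le_mul_of_nonneg_left e2 hT.le).trans
    (h.trans (mul_le_mul_of_nonneg_left hgT he))) (abs_nonneg _)

/-- With G the Gaussian term, g_μ − g·3/y = (3/y)·G·(y²/6 − 1). -/
lemma abs_div_sub_three_div_le {Δ β x e : ℝ} (hβ : |β| < 1) (hΔ : 0 < Δ)
    (hx : x - stableShift (2 - Δ) β ≠ 0) (he : 0 ≤ e)
    (h : gaussPart (2 - Δ) β x * (|x - stableShift (2 - Δ) β| ^ 2 / 6 + 1) ≤
      e * tailPart (2 - Δ) β x) :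
    |approxMu (2 - Δ) β x / approxDensity (2 - Δ) β x - 3 / (x - stableShift (2 - Δ) β)| ≤
      e * |3 / (x - stableShift (2 - Δ) β)| := by
  have hg := approxDensity_pos hβ hΔ hx
  have hφ : 0 < gaussPart (2 - Δ) β x := normalDensityTwo_pos _
  rw [div_sub' hg.ne', abs_div, abs_of_pos hg, div_le_iff₀ hg, approxMu_eq hx]
  have hgT : tailPart (2 - Δ) β x ≤ approxDensity (2 - Δ) β x := by
    rw [approxDensity]; linarith
  rw [sq_abs] at h
  set y := x - stableShift (2 - Δ) β
  have e1 : y / 2 * gaussPart (2 - Δ) β x + 3 / y * tailPart (2 - Δ) β x -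
      approxDensity (2 - Δ) β x * (3 / y) = 3 / y * (gaussPart (2 - Δ) β x * (y ^ 2 / 6 - 1)) := by
    rw [approxDensity]; field_simp; ring
  have e2 : |y ^ 2 / 6 - 1| ≤ y ^ 2 / 6 + 1 := by
    have : 0 ≤ y ^ 2 / 6 := by positivity
    exact abs_le.2 ⟨by linarith, by linarith⟩
  rw [e1, abs_mul, abs_mul, abs_of_pos hφ, mul_comm e, mul_assoc]
  exact mul_le_mul_of_nonneg_left ((mul_le_mul_of_nonneg_left e2 hφ.le).trans
    (h.trans (mul_le_mul_of_nonneg_left hgT he))) (abs_nonneg _)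

-- Here exp(−y²/4) ≥ Δ^((2−δ)²/4), so the tail is smaller by a factor of order Δ^(δ − δ²/4). This
-- beats Δ^(δ/2) because δ < 2.
open Filter Topology in
lemma eventually_abs_div_sub_div_two_le {β : ℝ} (hβ : |β| < 1) {δ r η : ℝ} (hδ₀ : 0 < δ)
    (hδ₂ : δ < 2) (hr : 0 < r) (hη : 0 < η) :
    ∀ᶠ Δ in 𝓝[>] (0 : ℝ), ∀ x : ℝ, r ≤ |x - stableShift (2 - Δ) β| →
      |x - stableShift (2 - Δ) β| ≤ (2 - δ) * Real.sqrt (Real.log (1 / Δ)) →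
      |approxMu (2 - Δ) β x / approxDensity (2 - Δ) β x - (x - stableShift (2 - Δ) β) / 2|
        ≤ η * Δ ^ (δ / 2) * |(x - stableShift (2 - Δ) β) / 2| := by
  -- Capping r at 1 gives |y|^(Δ−3) ≤ q^(−3) uniformly in Δ, including for small |y|.
  set q : ℝ := min r 1 with hq
  have hq0 : 0 < q := lt_min hr one_pos
  have hq1 : q ≤ 1 := min_le_right _ _
  have hκ : 0 < δ / 2 - δ ^ 2 / 4 := by nlinarith
  have hpi := Real.pi_pos
  filter_upwards [eventually_nhdsGT_mul_rpow_le
    (C := 2 * q ^ (-3 : ℝ) * (6 / q ^ 2 + 1)) hκ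
    (show 0 < η * (1 / (2 * Real.sqrt Real.pi)) by positivity),
    (eventually_lt_nhds (by norm_num : (0 : ℝ) < 1)).filter_mono nhdsWithin_le_nhds,
    self_mem_nhdsWithin] with Δ hC hΔ1 hΔ0 x hxr hxL
  have hΔ0 : 0 < Δ := hΔ0
  have hu0 : 0 < |x - stableShift (2 - Δ) β| := hr.trans_le hxr
  refine abs_div_sub_div_two_le hβ hΔ0 (abs_pos.1 hu0) (by positivity) ?_
  have hT := tailPart_le (x := x) hβ hΔ0
  have hlog : 0 ≤ Real.log (1 / Δ) :=
    Real.log_nonneg (by rw [le_div_iff₀ hΔ0]; linarith)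
  rw [gaussPart, normalDensityTwo, ← sq_abs (x - _)]
  set u := |x - stableShift (2 - Δ) β|
  have hqu : q ≤ u := (min_le_left _ _).trans hxr
  have hp : u ^ (Δ - 3) ≤ q ^ (-3 : ℝ) :=
    (Real.rpow_le_rpow_of_nonpos hq0 hqu (by linarith)).trans
      (Real.rpow_le_rpow_of_exponent_ge hq0 hq1 (by linarith))
  have hφ : Δ ^ ((2 - δ) ^ 2 / 4) ≤ Real.exp (-u ^ 2 / 4) := by
    rw [← exp_neg_mul_log_one_div hΔ0]
    refine Real.exp_le_exp.2 ?_
    have := pow_le_pow_left₀ hu0.le hxL 2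
    rw [mul_pow, Real.sq_sqrt hlog] at this
    linarith
  have hΔpow : Δ = Δ ^ (δ / 2 - δ ^ 2 / 4) * (Δ ^ (δ / 2) * Δ ^ ((2 - δ) ^ 2 / 4)) := by
    rw [← Real.rpow_add hΔ0, ← Real.rpow_add hΔ0]
    conv_lhs => rw [← Real.rpow_one Δ]
    congr 1
    ring
  calc tailPart (2 - Δ) β x * (6 / u ^ 2 + 1)
      ≤ 2 * (Δ * q ^ (-3 : ℝ)) * (6 / q ^ 2 + 1) := by
        refine mul_le_mul (hT.trans (by gcongr)) (by gcongr) (by positivity) (by positivity)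
    _ = 2 * q ^ (-3 : ℝ) * (6 / q ^ 2 + 1) * Δ := by ring
    _ = 2 * q ^ (-3 : ℝ) * (6 / q ^ 2 + 1) * Δ ^ (δ / 2 - δ ^ 2 / 4) *
          (Δ ^ (δ / 2) * Δ ^ ((2 - δ) ^ 2 / 4)) := by
        rw [mul_assoc _ (Δ ^ (δ / 2 - δ ^ 2 / 4)), ← hΔpow]
    _ ≤ η * (1 / (2 * Real.sqrt Real.pi)) * (Δ ^ (δ / 2) * Real.exp (-u ^ 2 / 4)) := by
        gcongr
    _ = _ := by ring

open Filter Topology in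
lemma eventually_abs_div_sub_three_div_le {β : ℝ} (hβ : |β| < 1) {δ η : ℝ} (hδ₀ : 0 < δ)
    (hη : 0 < η) :
    ∀ᶠ Δ in 𝓝[>] (0 : ℝ), ∀ x : ℝ,
      (2 + δ) * Real.sqrt (Real.log (1 / Δ)) ≤ |x - stableShift (2 - Δ) β| →
      |approxMu (2 - Δ) β x / approxDensity (2 - Δ) β x - 3 / (x - stableShift (2 - Δ) β)|
        ≤ η * Δ ^ (δ / 2) * |3 / (x - stableShift (2 - Δ) β)| := by
  have hb : 0 < 1 - |β| := by linarith
  -- The Gaussian exponent 1/4 is split as m + n. On this range exp(−m y²) ≤ Δ^(1+3δ/4), which is Δ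
  -- · Δ^(δ/2) with Δ^(δ/4) to spare; exp(−n y²) absorbs the powers of |y|, making the bound uniform
  -- for unbounded y.
  set m : ℝ := (1 + 3 * δ / 4) / (2 + δ) ^ 2 with hm
  have hm0 : 0 < m := by positivity
  have hn : 0 < 1 / 4 - m := by
    rw [hm, sub_pos, div_lt_iff₀ (by positivity)]
    nlinarith
  set n : ℝ := 1 / 4 - m with hndef
  have hκ : 0 < δ / 4 := by positivity
  have hpi := Real.pi_gt_three
  filter_upwards [eventually_nhdsGT_mul_rpow_le (C := 12 / n ^ 3) hκ
    (show 0 < η * (1 - |β|) by positivity),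
    eventually_nhdsGT_le_mul_sqrt_log 1 (by linarith : 0 < 2 + δ),
    (eventually_lt_nhds (by norm_num : (0 : ℝ) < 1)).filter_mono nhdsWithin_le_nhds,
    self_mem_nhdsWithin] with Δ hC hL hΔ1 hΔ0 x hxL
  have hΔ0 : 0 < Δ := hΔ0
  have hu1 : 1 ≤ |x - stableShift (2 - Δ) β| := hL.trans hxL
  have hu0 : 0 < |x - stableShift (2 - Δ) β| := by linarith
  refine abs_div_sub_three_div_le hβ hΔ0 (abs_pos.1 hu0) (by positivity) ?_
  have hT := le_tailPart (x := x) (β := β) hΔ0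
  have hlog : 0 ≤ Real.log (1 / Δ) :=
    Real.log_nonneg (by rw [le_div_iff₀ hΔ0]; linarith)
  rw [gaussPart, normalDensityTwo, ← sq_abs (x - _)]
  set u := |x - stableShift (2 - Δ) β|
  have hp : u ^ (-3 : ℝ) ≤ u ^ (Δ - 3) := Real.rpow_le_rpow_of_exponent_le hu1 (by linarith)
  have hu3 : u ^ (-3 : ℝ) * u ^ 3 = 1 := by
    rw [← Real.rpow_natCast, ← Real.rpow_add hu0]; norm_num
  have hconst : 1 / (2 * Real.sqrt Real.pi) ≤ 1 := by
    rw [div_le_one (by positivity)]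
    have := Real.one_le_sqrt.2 (by linarith : 1 ≤ Real.pi)
    linarith
  have hexp1 : Real.exp (-(m * u ^ 2)) ≤ Δ ^ (1 + 3 * δ / 4) := by
    rw [← exp_neg_mul_log_one_div hΔ0]
    refine Real.exp_le_exp.2 ?_
    have := pow_le_pow_left₀ (by positivity) hxL 2
    rw [mul_pow, Real.sq_sqrt hlog] at this
    have h2 := mul_le_mul_of_nonneg_left this hm0.le
    rw [← mul_assoc, hm, div_mul_cancel₀ _ (by positivity), ← hm] at h2
    linarith
  have hexp2 : Real.exp (-(n * u ^ 2)) * u ^ 6 ≤ 6 / n ^ 3 := by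
    have := Real.pow_div_factorial_le_exp (n * u ^ 2) (by positivity) 3
    rw [Real.exp_neg, inv_mul_le_iff₀ (Real.exp_pos _)]
    calc u ^ 6 = (n * u ^ 2) ^ 3 / (3 : ℕ).factorial * (6 / n ^ 3) := by
          norm_num [Nat.factorial]; field_simp
      _ ≤ _ := mul_le_mul_of_nonneg_right this (by positivity)
  have hsplit : Real.exp (-u ^ 2 / 4) = Real.exp (-(m * u ^ 2)) * Real.exp (-(n * u ^ 2)) := by
    rw [← Real.exp_add, hndef]; ring_nf
  have hpoly : u ^ 2 / 6 + 1 ≤ 2 * u ^ 6 * u ^ (-3 : ℝ) := by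
    have : 2 * u ^ 6 * u ^ (-3 : ℝ) = 2 * u ^ 3 * (u ^ (-3 : ℝ) * u ^ 3) := by ring
    rw [this, hu3, mul_one]
    have h2 : u ^ 2 ≤ u ^ 3 := pow_le_pow_right₀ hu1 (by norm_num)
    have h3 : 1 ≤ u ^ 3 := one_le_pow₀ hu1
    linarith
  have hΔpow : Δ ^ (1 + 3 * δ / 4) = Δ ^ (δ / 4) * (Δ ^ (δ / 2) * Δ) := by
    nth_rewrite 4 [← Real.rpow_one Δ]
    rw [← Real.rpow_add hΔ0, ← Real.rpow_add hΔ0]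
    congr 1
    ring
  calc 1 / (2 * Real.sqrt Real.pi) * Real.exp (-u ^ 2 / 4) * (u ^ 2 / 6 + 1)
      ≤ 1 * Real.exp (-u ^ 2 / 4) * (2 * u ^ 6 * u ^ (-3 : ℝ)) := by gcongr
    _ = 2 * Real.exp (-(m * u ^ 2)) * (Real.exp (-(n * u ^ 2)) * u ^ 6) * u ^ (-3 : ℝ) := by
        rw [hsplit]; ring
    _ ≤ 2 * Δ ^ (1 + 3 * δ / 4) * (6 / n ^ 3) * u ^ (Δ - 3) := by gcongr
    _ = 12 / n ^ 3 * Δ ^ (δ / 4) * (Δ ^ (δ / 2) * (Δ * u ^ (Δ - 3))) := by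
        rw [hΔpow]; ring
    _ ≤ η * (1 - |β|) * (Δ ^ (δ / 2) * (Δ * u ^ (Δ - 3))) := by gcongr
    _ = η * Δ ^ (δ / 2) * ((1 - |β|) * (Δ * u ^ (Δ - 3))) := by ring
    _ ≤ _ := mul_le_mul_of_nonneg_left hT (by positivity)

/-- A weighted mean of |y|/2 and 3/|y|, neither of which exceeds |y| once |y| ≥ 3. -/
lemma abs_approxMu_div_approxDensity_le {Δ β x : ℝ} (hβ : |β| < 1) (hΔ : 0 < Δ)
    (hx : 3 ≤ |x - stableShift (2 - Δ) β|) :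
    |approxMu (2 - Δ) β x / approxDensity (2 - Δ) β x| ≤ |x - stableShift (2 - Δ) β| := by
  have hu : 0 < |x - stableShift (2 - Δ) β| := by linarith
  have hne := abs_pos.1 hu
  have hg := approxDensity_pos hβ hΔ hne
  have hT := tailPart_pos hβ hΔ hne
  have hφ : 0 < gaussPart (2 - Δ) β x := normalDensityTwo_pos _
  rw [abs_div, abs_of_pos hg, div_le_iff₀ hg, abs_approxMu_eq hβ hΔ hne, approxDensity, mul_add]
  refine add_le_add ?_ ?_
  · exact mul_le_mul_of_nonneg_right (by linarith) hφ.le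
  · refine mul_le_mul_of_nonneg_right ?_ hT.le
    rw [div_le_iff₀ hu]
    nlinarith

open Filter Topology in
lemma eventually_abs_stableShift_lt {β : ℝ} (hβ : |β| < 1) {r : ℝ} (hr : 0 < r) :
    ∀ᶠ Δ in 𝓝[>] (0 : ℝ), |stableShift (2 - Δ) β| < r := by
  filter_upwards [(eventually_abs_stableShift_le hβ.le).filter_mono nhdsWithin_le_nhds,
    (eventually_lt_nhds (half_pos hr)).filter_mono nhdsWithin_le_nhds,
    self_mem_nhdsWithin] with Δ h1 h2 h3
  rw [abs_of_pos (Set.mem_Ioi.1 h3)] at h1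
  linarith

/-! ### Assembly of the three claims -/

theorem mainTheorem4 (β : ℝ) (hβ₁ : -1 < β) (hβ₂ : β < 1) :
    (∀ ε : ℝ, 0 < ε → ∃ Δ₀ : ℝ, 0 < Δ₀ ∧ ∃ x₀ : ℝ, 0 < x₀ ∧
      ∀ Δ x : ℝ, 0 < Δ → Δ < Δ₀ → x₀ < |x| →
        |stableDensityMu (2 - Δ) β x / approxMu (2 - Δ) β x - 1| < ε ∧
        |(stableDensityMu (2 - Δ) β x / stableDensity 0 1 (2 - Δ) β x) /
            (approxMu (2 - Δ) β x / approxDensity (2 - Δ) β x) - 1| < ε) ∧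
    (∀ δ : ℝ, 0 < δ → δ < 2 → ∀ x₀ : ℝ, 0 < x₀ → ∀ η : ℝ, 0 < η →
      ∃ Δ₀ : ℝ, 0 < Δ₀ ∧ ∀ Δ x : ℝ, 0 < Δ → Δ < Δ₀ → x₀ < |x| →
        (|x - stableShift (2 - Δ) β| ≤ (2 - δ) * Real.sqrt (Real.log (1 / Δ)) →
          |approxMu (2 - Δ) β x / approxDensity (2 - Δ) β x
              - (x - stableShift (2 - Δ) β) / 2|
            ≤ η * Δ ^ (δ / 2) * |(x - stableShift (2 - Δ) β) / 2|) ∧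
        ((2 + δ) * Real.sqrt (Real.log (1 / Δ)) ≤ |x - stableShift (2 - Δ) β| →
          |approxMu (2 - Δ) β x / approxDensity (2 - Δ) β x
              - 3 / (x - stableShift (2 - Δ) β)|
            ≤ η * Δ ^ (δ / 2) * |3 / (x - stableShift (2 - Δ) β)|)) ∧
    (∃ c : ℝ, 0 < c ∧ ∀ δ : ℝ, 0 < δ → δ < 2 → ∀ x₀ : ℝ, 0 < x₀ →
      ∃ Δ₀ : ℝ, 0 < Δ₀ ∧ ∀ Δ x : ℝ, 0 < Δ → Δ < Δ₀ → x₀ < |x| →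
        (((2 - δ) * Real.sqrt (Real.log (1 / Δ)) ≤ |x - stableShift (2 - Δ) β| ∧
            |x - stableShift (2 - Δ) β| ≤ (2 + δ) * Real.sqrt (Real.log (1 / Δ))) ∨
          ((2 - δ) * Real.sqrt (Real.log (1 / Δ)) ≤ |x| ∧
            |x| ≤ (2 + δ) * Real.sqrt (Real.log (1 / Δ)))) →
        |approxMu (2 - Δ) β x / approxDensity (2 - Δ) β x| ≤ c * |x|) := by
  have hβ : |β| < 1 := abs_lt.2 ⟨hβ₁, hβ₂⟩
  -- The constant c = 2 comes from |y| ≤ |x| + |ζ| ≤ 2|x|, as |ζ| < 1 ≤ |x|.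
  refine ⟨fun ε hε => ?_, fun δ hδ₀ hδ₂ x₀ hx₀ η hη => ?_, 2, two_pos,
    fun δ hδ₀ hδ₂ x₀ hx₀ => ?_⟩
  -- If p and q are within e of 1, then |p/q − 1| ≤ 2e/(1 − e) ≤ 8e/3 < ε.
  · set e : ℝ := min ε 1 / 4 with he
    have he0 : 0 < e := by positivity
    have he1 : e ≤ 1 / 4 := by rw [he]; linarith [min_le_right ε 1]
    have heε : e ≤ ε / 4 := by rw [he]; linarith [min_le_left ε 1]
    obtain ⟨y₀, hy₀, h⟩ := exists_abs_stableDensity_sub_approxDensity_le hβ₁ hβ₂ he0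
    obtain ⟨Δ₀, hΔ₀, H⟩ :=
      exists_forall_of_eventually_nhdsGT_zero (h.and (eventually_abs_stableShift_lt hβ one_pos))
    refine ⟨Δ₀, hΔ₀, y₀ + 1, by linarith, fun Δ x h0 h1 hx => ?_⟩
    obtain ⟨h2, hζ⟩ := H Δ h0 h1
    have hy : y₀ < |x - stableShift (2 - Δ) β| := by
      have := abs_sub_abs_le_abs_sub x (stableShift (2 - Δ) β)
      linarith
    obtain ⟨h3, h4⟩ := h2 x hy
    have hne : x - stableShift (2 - Δ) β ≠ 0 := abs_pos.1 (by linarith)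
    have hg := approxDensity_pos hβ h0 hne
    have hgμ : 0 < |approxMu (2 - Δ) β x| := by
      rw [abs_approxMu_eq hβ h0 hne]
      have := tailPart_pos hβ h0 hne
      have : 0 < gaussPart (2 - Δ) β x := normalDensityTwo_pos _
      have := abs_pos.2 hne
      positivity
    have hp : |stableDensityMu (2 - Δ) β x / approxMu (2 - Δ) β x - 1| ≤ e := by
      rw [div_sub_one (abs_pos.1 hgμ), abs_div, div_le_iff₀ hgμ]
      exact h4
    have hq : |stableDensity 0 1 (2 - Δ) β x / approxDensity (2 - Δ) β x - 1| ≤ e := by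
      rw [div_sub_one hg.ne', abs_div, abs_of_pos hg, div_le_iff₀ hg]
      exact h3
    refine ⟨by linarith, ?_⟩
    rw [div_div_div_comm]
    set p := stableDensityMu (2 - Δ) β x / approxMu (2 - Δ) β x
    set q := stableDensity 0 1 (2 - Δ) β x / approxDensity (2 - Δ) β x
    rw [abs_le] at hp hq
    have hq0 : 0 < q := by linarith
    rw [div_sub_one hq0.ne', abs_div, abs_of_pos hq0, div_lt_iff₀ hq0, abs_lt]
    constructor <;> nlinarith
  · obtain ⟨Δ₀, hΔ₀, H⟩ := exists_forall_of_eventually_nhdsGT_zero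
      ((eventually_abs_div_sub_div_two_le hβ hδ₀ hδ₂ (half_pos hx₀) hη).and
        ((eventually_abs_div_sub_three_div_le hβ hδ₀ hη).and
          (eventually_abs_stableShift_lt hβ (half_pos hx₀))))
    refine ⟨Δ₀, hΔ₀, fun Δ x h0 h1 hx => ?_⟩
    obtain ⟨h2, h3, hζ⟩ := H Δ h0 h1
    refine ⟨h2 x ?_, h3 x⟩
    have := abs_sub_abs_le_abs_sub x (stableShift (2 - Δ) β)
    linarith
  · obtain ⟨Δ₀, hΔ₀, H⟩ := exists_forall_of_eventually_nhdsGT_zero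
      -- The threshold 4, less |ζ| < 1, leaves |y| ≥ 3 whichever of |y| and |x| lies in the
      -- interval.
      ((eventually_nhdsGT_le_mul_sqrt_log 4 (by linarith : 0 < 2 - δ)).and
        (eventually_abs_stableShift_lt hβ one_pos))
    refine ⟨Δ₀, hΔ₀, fun Δ x h0 h1 _ hint => ?_⟩
    obtain ⟨hL, hζ⟩ := H Δ h0 h1
    have e1 := abs_sub_abs_le_abs_sub x (stableShift (2 - Δ) β)
    have e2 := abs_sub x (stableShift (2 - Δ) β)
    have hu : 3 ≤ |x - stableShift (2 - Δ) β| := by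
      rcases hint with h | h <;> linarith [h.1]
    have hx1 : 1 ≤ |x| := by linarith
    exact (abs_approxMu_div_approxDensity_le hβ h0 hu).trans (by linarith)
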